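/- All graphs are finite and simple. For an integer $q\ge 3$, a graph $G$ is $K_q$-divisible if $\binom q2 \mid e(G)$ and $(q-1)\mid d_G(v)$ for every $v\in V(G)$; a $K_q$-decomposition of $G$ is a collection of copies of $K_q$ in $G$ whose edge sets partition $E(G)$. A $K_q$-absorber for a $K_q$-divisible graph $L$ is a graph $A$ such that $V(L)\subseteq V(A)$ is an independent set of $A$ and both $A$ and $L\cup A$ admit $K_q$-decompositions. For a graph $H$ and an independent set $R\subseteq V(H)$ of $H$, let $$m(H,R)=\max\left\{\frac{e(H')}{|V(H')\setminus R|}: H'\subseteq H,\ V(H')\setminus R\neq\emptyset\right\},\qquad m_2(H)=\max\left\{\frac{e(H')-1}{v(H')-2}: H'\subseteq H,\ v(H')\ge 3\right\},$$ and $m_2(H,R)=\max\{m(H,R),m_2(H)\}$ (a maximum over the empty set is $-\infty$). Let $d_{\mathrm{abs}}(K_q)$ be the infimum (which is $+\infty$ if there are none) of all positive real numbers $r$ such that for every positive integer $C_1$ there exists a positive integer $C_2$ such that every $K_q$-divisible graph $L$ on at most $C_1$ vertices has a $K_q$-absorber $A$ on at most $C_2$ vertices with $m_2(A,V(L))\le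 r$. Theorem. For every integer $q\ge 4$, $d_{\mathrm{abs}}(K_q)\le q+\tfrac12$. -/

import Mathlib

/-- `G` is `K_q`-divisible: `q choose 2` divides the number of edges and `q - 1` divides every
degree (used for `q ≥ 1` and graphs on finite vertex sets). -/
def IsCliqueDivisible (q : ℕ) {V : Type} (G : SimpleGraph V) : Prop :=
  q.choose 2 ∣ G.edgeSet.ncard ∧ ∀ v, (q - 1) ∣ (G.neighborSet v).ncard

/-- `G` admits a `K_q`-decomposition. A copy of `K_q` in `G` is given by its vertex set, a
`q`-clique of `G`; every edge of `G` lies in exactly one copy of the collection `D`. -/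
def HasCliqueDecomposition (q : ℕ) {V : Type} (G : SimpleGraph V) : Prop :=
  ∃ D : Set (Finset V), (∀ K ∈ D, G.IsNClique q K) ∧
    ∀ u v, G.Adj u v → ∃! K, K ∈ D ∧ u ∈ K ∧ v ∈ K

/-- The graph `A` is a `K_q`-absorber for `L`, where the vertex set `V` of `L` is regarded as a
subset of the vertex set `W` of `A` through the injection `f`: the set `V(L)` is independent in `A`,
and both `A` and `L ∪ A` admit `K_q`-decompositions. -/
def IsCliqueAbsorber (q : ℕ) {V W : Type} (L : SimpleGraph V) (f : V ↪ W)
    (A : SimpleGraph W) : Prop :=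
  A.IsIndepSet (Set.range f) ∧
    HasCliqueDecomposition q A ∧ HasCliqueDecomposition q (L.map f ⊔ A)

/-- The maximum rooted density `m(H, R)` of a finite graph: the maximum of
`e(H') / |V(H') \ R|` over subgraphs `H'` of `H` with `V(H') \ R ≠ ∅`
(and `-∞` if there is no such subgraph). -/
noncomputable def maxRootedDensity {W : Type} (H : SimpleGraph W) (R : Set W) : EReal :=
  ⨆ (H' : H.Subgraph) (_ : (H'.verts \ R).Nonempty),
    (((H'.edgeSet.ncard : ℝ) / ((H'.verts \ R).ncard : ℝ) : ℝ) : EReal)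

/-- The maximum `2`-density `m_2(H)` of a finite graph: the maximum of
`(e(H') - 1) / (v(H') - 2)` over subgraphs `H'` of `H` with at least three vertices
(and `-∞` if there is no such subgraph). -/
noncomputable def maxTwoDensity {W : Type} (H : SimpleGraph W) : EReal :=
  ⨆ (H' : H.Subgraph) (_ : 3 ≤ H'.verts.ncard),
    ((((H'.edgeSet.ncard : ℝ) - 1) / ((H'.verts.ncard : ℝ) - 2) : ℝ) : EReal)

/-- The maximum rooted `2`-density `m_2(H, R) = max {m(H, R), m_2(H)}`. -/
noncomputable def maxRootedTwoDensity {W : Type} (H : SimpleGraph W) (R : Set W) : EReal :=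
  max (maxRootedDensity H R) (maxTwoDensity H)

/-- For every `C₁` there is `C₂` such that every `K_q`-divisible graph `L` on at most `C₁` vertices
has a `K_q`-absorber `A` on at most `C₂` vertices with `m_2(A, V(L)) ≤ r`. -/
def HasAbsorbersOfTwoDensity (q : ℕ) (r : ℝ) : Prop :=
  ∀ C₁ : ℕ, 0 < C₁ → ∃ C₂ : ℕ, 0 < C₂ ∧
    ∀ (V : Type) [Finite V] (L : SimpleGraph V), Nat.card V ≤ C₁ → IsCliqueDivisible q L →
      ∃ (W : Type) (_ : Finite W) (f : V ↪ W) (A : SimpleGraph W),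
        Nat.card W ≤ C₂ ∧ IsCliqueAbsorber q L f A ∧
          maxRootedTwoDensity A (Set.range f) ≤ (r : EReal)

/-- The `K_q`-absorber rooted `2`-density threshold `d_abs(K_q)`: the infimum of all positive real
numbers `r` with `HasAbsorbersOfTwoDensity q r`, taken in the extended reals (so that it is `+∞`
if there is no such `r`). -/
noncomputable def absorberThreshold (q : ℕ) : EReal :=
  ⨅ (r : ℝ) (_ : 0 < r) (_ : HasAbsorbersOfTwoDensity q r), (r : EReal)

/-! Fix a finite set N containing V(L) and some spare vertices. An absorber comes from two families
D₁, D₂ of q-sets that cover every pair not inside N equally often and at most once, where D₁ covers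
no pair inside N and D₂ covers there exactly the edges of L: take A to be the graph covered by D₁,
so that D₂ decomposes L ∪ A.

Divisibility makes the indicator of L an integer combination of q-cliques on N
(`indicator_mem_cliqueLattice`). Starting from empty families, these cliques are added one at a time
to D₂ (or to D₁, for the opposite sign), and the families are repaired by trades. The points (a, s)
of a trade, with a in (ZMod 3)^(q-1), form rows and columns of q - 1 points each; joining rows to x
and columns to x' covers the same pairs as joining rows to x' and columns to x. A trade whose zero
row completes x to a clique K replaces x by a fresh vertex x' in K (`IsBalancedPair.reduce`);
iterating, every clique keeps at most two vertices in N. If K₂ in D₁ and K in D₂ share a pair {x, m}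
inside N, a trade with K as a row and K₂ as a column crossing at m eliminates both
(`IsBalancedPair.close`). As the indicator of L is nonnegative, this runs until D₁ covers nothing
inside N.

For the density, a new point has 2(q - 2) neighbours among the points, whose edges are shared half
and half, and two hubs: q edges in all. The bound q + 1/2 leaves half an edge, which is what it
costs to pay in full for one edge to an old point. The incidence structure has no 4-cycles, so one
such surcharge suffices, except for points that also carry a port, which give up their row pairs. A
new hub can afford q - 1 old neighbours, but in `close` it has up to 2q - 3. The surplus is prepaid
by ports: a vertex outside N in a clique with two vertices in N reserves one further edge, counted
in the invariant `IsSparse` and spent in `IsSparse.extend`. -/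

/-! ### Sparsity counts and hub extensions -/

/-- The number of ordered pairs (weighted by `g`) inside `S`. -/
def pairSum (g : ℕ → ℕ → ℕ) (S : Finset ℕ) : ℕ := ∑ u ∈ S, ∑ v ∈ S, g u v

/-- The sparsity conditions kept throughout the construction: `g` is the adjacency indicator of the
graph built so far on `X`, and `y` marks the vertices that may receive one more edge. -/
structure IsSparse (q : ℕ) (N X : Finset ℕ) (g : ℕ → ℕ → ℕ) (y : ℕ → ℕ) : Prop where
  rooted : ∀ S ⊆ X, pairSum g S + 2 * ∑ u ∈ S, y u ≤ (2 * q + 1) * (S \ N).card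
  -- With `pairSum` twice the number of edges, this is (e - 1)/(v - 2) ≤ q + 1/2 cleared of
  -- denominators.
  two : ∀ S ⊆ X, 2 ≤ S.card → pairSum g S + 4 * q ≤ (2 * q + 1) * S.card
  -- The intermediate bound (e + ports)/(v - 1) ≤ q + 1/2 keeps `two` true when a hub is joined to
  -- many ports at once.
  port : ∀ S ⊆ X, 2 ≤ S.card →
    pairSum g S + 2 * ∑ u ∈ S, y u + (2 * q + 1) ≤ (2 * q + 1) * S.card

lemma pairSum_le {g : ℕ → ℕ → ℕ} (hle : ∀ u v, g u v ≤ 1) (hloop : ∀ u, g u u = 0)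
    (S : Finset ℕ) : pairSum g S + S.card ≤ S.card * S.card := by
  have h : ∀ u ∈ S, ∑ v ∈ S, g u v + 1 ≤ S.card := by
    intro u hu
    have h1 : ∑ v ∈ S, g u v = ∑ v ∈ S.erase u, g u v := by
      rw [← Finset.add_sum_erase S _ hu, hloop, zero_add]
    have h2 : ∑ v ∈ S.erase u, g u v ≤ (S.erase u).card * 1 :=
      Finset.sum_le_card_nsmul _ _ _ fun v _ => hle u v
    have h3 := Finset.card_erase_add_one hu
    omega
  calc pairSum g S + S.card = ∑ u ∈ S, (∑ v ∈ S, g u v + 1) := by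
        simp [pairSum, Finset.sum_add_distrib]
    _ ≤ S.card * S.card := Finset.sum_le_card_nsmul _ _ _ h

lemma pairSum_union {g : ℕ → ℕ → ℕ} (hsymm : ∀ u v, g u v = g v u) {S T : Finset ℕ}
    (h : Disjoint S T) :
    pairSum g (S ∪ T) = pairSum g S + pairSum g T + 2 * ∑ u ∈ T, ∑ v ∈ S, g u v := by
  have h1 : ∑ u ∈ S, ∑ v ∈ T, g u v = ∑ u ∈ T, ∑ v ∈ S, g u v := by
    rw [Finset.sum_comm]
    exact Finset.sum_congr rfl fun u _ => Finset.sum_congr rfl fun v _ => hsymm _ _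
  simp only [pairSum, Finset.sum_union h, Finset.sum_add_distrib]
  rw [h1]; ring

/-- The sum over pairs is bounded through a fractional orientation `ω`. -/
lemma pairSum_le_orientation {g ω : ℕ → ℕ → ℕ} {T : Finset ℕ}
    (h : ∀ u ∈ T, ∀ v ∈ T, 2 * g u v ≤ ω u v + ω v u) :
    pairSum g T ≤ ∑ u ∈ T, ∑ v ∈ T, ω u v := by
  have h1 : ∑ u ∈ T, ∑ v ∈ T, 2 * g u v ≤ ∑ u ∈ T, ∑ v ∈ T, (ω u v + ω v u) :=
    Finset.sum_le_sum fun u hu => Finset.sum_le_sum fun v hv => h u hu v hv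
  have h2 : ∑ u ∈ T, ∑ v ∈ T, ω v u = ∑ u ∈ T, ∑ v ∈ T, ω u v := Finset.sum_comm
  simp only [Finset.sum_add_distrib, h2, ← Finset.mul_sum] at h1
  unfold pairSum
  omega

/-- The hypotheses under which a hub `x'` and a set `M` of vertices joined to both `x` and `x'` may
be added to a sparse graph: `ω` orients the new edges away from the hubs fractionally. -/
structure IsHubExtension (q : ℕ) (X M : Finset ℕ) (g g' ω : ℕ → ℕ → ℕ) (y y' p₀ p₁ : ℕ → ℕ)
    (x x' : ℕ) : Prop where
  hub_mem : x ∈ X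
  hub_notMem : x' ∉ X
  disj : Disjoint X M
  hub_notMem_new : x' ∉ M
  old : ∀ u ∈ X, ∀ v ∈ X, g' u v = g u v
  symm : ∀ u v, g' u v = g' v u
  le_one : ∀ u v, g' u v ≤ 1
  loopless : ∀ u, g' u u = 0
  hubs : g' x' x = 0
  root : ∀ u ∈ M, ∀ v ∈ X, v ≠ x → 2 * g' u v ≤ ω u v
  new : ∀ u ∈ M, ∀ v ∈ M, 2 * g' u v ≤ ω u v + ω v u
  -- In units of half an edge a new vertex may spend 2q + 1. Its edges to x and x' cost 4, so its
  -- weight and port may use 2q - 3.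
  out_le : ∀ u ∈ M, ∑ v ∈ (X ∪ M).erase x, ω u v + 2 * y' u + 3 ≤ 2 * q
  hub_le : ∀ u ∈ X, g' x' u ≤ p₀ u + p₁ u
  port_add_le : ∀ u ∈ X, y' u + p₁ u ≤ y u
  port_hub : y' x' ≤ 1
  sum_le : ∑ u ∈ X, p₀ u + 1 ≤ q
  -- The two alternatives are the situations of `reduce` and `close`; they decide which old bound
  -- implies the new `two`.
  paid : (∀ u ∈ X, p₁ u = 0) ∨ ∑ u ∈ X, p₀ u ≤ 1

namespace IsHubExtension

variable {q : ℕ} {X M : Finset ℕ} {g g' ω : ℕ → ℕ → ℕ} {y y' p₀ p₁ : ℕ → ℕ} {x x' : ℕ}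

lemma pairSum_old (h : IsHubExtension q X M g g' ω y y' p₀ p₁ x x') {R : Finset ℕ} (hR : R ⊆ X) :
    pairSum g' R = pairSum g R :=
  Finset.sum_congr rfl fun u hu => Finset.sum_congr rfl fun v hv => h.old u (hR hu) v (hR hv)

lemma sum_root_le (h : IsHubExtension q X M g g' ω y y' p₀ p₁ x x') {R : Finset ℕ} (hR : R ⊆ X)
    {u : ℕ} (hu : u ∈ M) :
    2 * ∑ v ∈ R, g' u v ≤ ∑ v ∈ R.erase x, ω u v + 2 * (if x ∈ R then 1 else 0) := by
  have h1 : ∑ v ∈ R.erase x, 2 * g' u v ≤ ∑ v ∈ R.erase x, ω u v :=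
    Finset.sum_le_sum fun v hv =>
      h.root u hu v (hR (Finset.mem_of_mem_erase hv)) (Finset.ne_of_mem_erase hv)
  rw [← Finset.mul_sum] at h1
  split_ifs with hx
  · rw [← Finset.add_sum_erase R _ hx]
    have := h.le_one u x
    omega
  · rw [Finset.erase_eq_of_notMem hx] at h1 ⊢
    omega

/-- Each vertex of T pays in full for its edges into R and by ω for its share of the edges inside T.
The edge to x is not covered by ω and costs 2 when x ∈ R. -/
lemma pairSum_union_le (h : IsHubExtension q X M g g' ω y y' p₀ p₁ x x') {R T : Finset ℕ}
    (hR : R ⊆ X) (hT : T ⊆ M) :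
    pairSum g' (R ∪ T) + 2 * ∑ u ∈ T, y' u + 3 * T.card ≤
      pairSum g R + T.card * (2 * q + 2 * (if x ∈ R then 1 else 0)) := by
  have hRT : Disjoint R T := h.disj.mono hR hT
  have h1 : pairSum g' T ≤ ∑ u ∈ T, ∑ v ∈ T, ω u v :=
    pairSum_le_orientation fun u hu v hv => h.new u (hT hu) v (hT hv)
  have h2 : ∀ u ∈ T, ∑ v ∈ T, ω u v + 2 * ∑ v ∈ R, g' u v + 2 * y' u + 3 ≤
      2 * q + 2 * (if x ∈ R then 1 else 0) := by
    intro u hu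
    have h3 := h.sum_root_le hR (hT hu)
    have h4 := h.out_le u (hT hu)
    have h5 : ∑ v ∈ R.erase x, ω u v + ∑ v ∈ T, ω u v ≤ ∑ v ∈ (X ∪ M).erase x, ω u v := by
      rw [← Finset.sum_union (hRT.mono_left (Finset.erase_subset _ _))]
      refine Finset.sum_le_sum_of_subset ?_
      intro v hv
      rcases Finset.mem_union.1 hv with hv | hv
      · exact Finset.mem_erase.2 ⟨Finset.ne_of_mem_erase hv,
          Finset.mem_union_left _ (hR (Finset.mem_of_mem_erase hv))⟩
      · refine Finset.mem_erase.2 ⟨?_, Finset.mem_union_right _ (hT hv)⟩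
        intro hvx
        exact Finset.disjoint_left.1 h.disj h.hub_mem (hvx ▸ hT hv)
    omega
  have h6 := Finset.sum_le_card_nsmul _ _ _ h2
  simp only [Finset.sum_add_distrib, ← Finset.mul_sum, Finset.sum_const, smul_eq_mul] at h6
  rw [pairSum_union h.symm hRT, h.pairSum_old hR]
  omega

lemma pairSum_insert_le (h : IsHubExtension q X M g g' ω y y' p₀ p₁ x x') {R T : Finset ℕ}
    (hR : R ⊆ X) (hT : T ⊆ M) :
    pairSum g' (insert x' (R ∪ T)) ≤
      pairSum g' (R ∪ T) + 2 * T.card + 2 * ∑ u ∈ R, g' x' u := by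
  have hx : Disjoint (R ∪ T) {x'} := by
    simp only [Finset.disjoint_singleton_right, Finset.mem_union, not_or]
    exact ⟨fun hh => h.hub_notMem (hR hh), fun hh => h.hub_notMem_new (hT hh)⟩
  have h1 : ∑ u ∈ T, g' x' u ≤ T.card * 1 :=
    Finset.sum_le_card_nsmul _ _ _ fun v _ => h.le_one _ v
  rw [Finset.insert_eq, Finset.union_comm, pairSum_union h.symm hx]
  simp only [Finset.sum_singleton, Finset.sum_union (h.disj.mono hR hT)]
  have : pairSum g' {x'} = 0 := by simp [pairSum, h.loopless]
  omega

/-- The hubs are not adjacent, so x ∈ R leaves a vertex of R that x' does not see. This matters when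
R has at most one vertex and the old bounds say nothing. -/
lemma sum_hub_add_le (h : IsHubExtension q X M g g' ω y y' p₀ p₁ x x') (R : Finset ℕ) :
    ∑ u ∈ R, g' x' u + (if x ∈ R then 1 else 0) ≤ R.card := by
  have h1 : ∑ u ∈ R.erase x, g' x' u ≤ (R.erase x).card * 1 :=
    Finset.sum_le_card_nsmul _ _ _ fun v _ => h.le_one _ v
  split_ifs with hx
  · rw [← Finset.add_sum_erase R _ hx, h.hubs]
    have := Finset.card_erase_add_one hx
    omega
  · rw [Finset.erase_eq_of_notMem hx] at h1
    omega

lemma subset_cases {S : Finset ℕ} (hS : S ⊆ insert x' (X ∪ M)) :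
    ∃ R ⊆ X, ∃ T ⊆ M, S = R ∪ T ∨ S = insert x' (R ∪ T) := by
  refine ⟨S ∩ X, Finset.inter_subset_right, S ∩ M, Finset.inter_subset_right, ?_⟩
  by_cases hx : x' ∈ S
  · right
    ext u
    have := @hS u
    simp only [Finset.mem_insert, Finset.mem_union, Finset.mem_inter] at this ⊢
    constructor
    · tauto
    · rintro (rfl | h)
      · exact hx
      · tauto
  · left
    ext u
    have := @hS u
    simp only [Finset.mem_insert, Finset.mem_union, Finset.mem_inter] at this ⊢
    constructor
    · intro hu
      rcases this hu with rfl | h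
      · exact absurd hu hx
      · tauto
    · tauto

lemma card_insert_union (h : IsHubExtension q X M g g' ω y y' p₀ p₁ x x') {R T : Finset ℕ}
    (hR : R ⊆ X) (hT : T ⊆ M) : (insert x' (R ∪ T)).card = R.card + T.card + 1 := by
  rw [Finset.card_insert_of_notMem, Finset.card_union_of_disjoint (h.disj.mono hR hT)]
  rw [Finset.mem_union, not_or]
  exact ⟨fun hh => h.hub_notMem (hR hh), fun hh => h.hub_notMem_new (hT hh)⟩

lemma sum_insert_union (h : IsHubExtension q X M g g' ω y y' p₀ p₁ x x') {R T : Finset ℕ}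
    (hR : R ⊆ X) (hT : T ⊆ M) (f : ℕ → ℕ) :
    ∑ u ∈ insert x' (R ∪ T), f u = ∑ u ∈ R, f u + ∑ u ∈ T, f u + f x' := by
  rw [Finset.sum_insert, Finset.sum_union (h.disj.mono hR hT), add_comm]
  rw [Finset.mem_union, not_or]
  exact ⟨fun hh => h.hub_notMem (hR hh), fun hh => h.hub_notMem_new (hT hh)⟩

lemma card_sdiff (h : IsHubExtension q X M g g' ω y y' p₀ p₁ x x') {N R T : Finset ℕ}
    (hN : N ⊆ X) (hR : R ⊆ X) (hT : T ⊆ M) :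
    ((R ∪ T) \ N).card = (R \ N).card + T.card ∧
      (insert x' (R ∪ T) \ N).card = (R \ N).card + T.card + 1 := by
  have h1 : (R ∪ T) \ N = R \ N ∪ T := by
    rw [Finset.union_sdiff_distrib,
      Finset.sdiff_eq_self_of_disjoint (h.disj.symm.mono hT hN)]
  have h2 : insert x' (R ∪ T) \ N = insert x' (R \ N ∪ T) := by
    rw [Finset.insert_sdiff_of_notMem _ fun hh => h.hub_notMem (hN hh), h1]
  have hR' : R \ N ⊆ X := Finset.sdiff_subset.trans hR
  rw [h2, h1, h.card_insert_union hR' hT, Finset.card_union_of_disjoint (h.disj.mono hR' hT)]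
  exact ⟨rfl, rfl⟩

end IsHubExtension

/-- Small sets satisfy the bounds for trivial reasons. -/
lemma two_of_small {q e s : ℕ} (hs : 2 ≤ s) (hsq : s ≤ 2 * q) (he : e + s ≤ s * s) :
    e + 4 * q ≤ (2 * q + 1) * s := by
  -- Since e ≤ s(s - 1), the slack is at least (s - 2)(2q - s) = t * r.
  obtain ⟨t, rfl⟩ := Nat.exists_eq_add_of_le hs
  obtain ⟨r, hr⟩ := Nat.exists_eq_add_of_le hsq
  nlinarith [Nat.zero_le (t * r)]

/-- The claim reduces to s² + 1 ≤ 2q(s - 1). For s ≥ 3 this follows from s ≤ q, and for s = 2 it is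
5 ≤ 2q. -/
lemma port_of_small {q e s z : ℕ} (hq : 4 ≤ q) (hs : 2 ≤ s) (hsq : s ≤ q) (he : e + s ≤ s * s) (hz : z ≤ s) :
    e + 2 * z + (2 * q + 1) ≤ (2 * q + 1) * s := by
  obtain ⟨t, rfl⟩ := Nat.exists_eq_add_of_le hs
  obtain ⟨r, rfl⟩ := Nat.exists_eq_add_of_le hsq
  rcases Nat.eq_zero_or_pos t with rfl | ht
  · nlinarith
  · nlinarith [Nat.zero_le (t * r)]

/-- Each of the k new vertices adds at most 2q - 1. For r ≤ 1 there is no old inequality, but also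
no old edge, and k is large. -/
lemma two_of_extension {q r k i G E E₁ : ℕ} (hbig : 2 * q < r + k) (hi : i ≤ 1) (hG : G + i ≤ r)
    (h₁ : E₁ + 3 * k ≤ E + k * (2 * q + 2 * i)) (h : 2 ≤ r → E + 4 * q ≤ (2 * q + 1) * r)
    (h₀ : r ≤ 1 → E = 0) : E₁ + 4 * q ≤ (2 * q + 1) * (r + k) := by
  rcases Nat.lt_or_ge r 2 with hr | hr
  · have := h₀ (by omega)
    interval_cases r <;> interval_cases i <;> first | omega | nlinarith
  · have := h hr
    interval_cases i <;> nlinarith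

/-- If no port is spent, the hub adds at most 2(q - 1) to the old `two`. If P ≤ 1, it adds at most 2
+ 2Y, and the old `port` bound absorbs 2Y: from 2q + 1 to 4q on the left is 2q - 1, so with 2 the
increase is exactly the 2q + 1 that the hub brings. -/
lemma two_of_hub_extension {q r k i G E E₁ E₂ Y P P₀ P₁ : ℕ} (hq : 4 ≤ q)
    (hbig : 2 * q < r + k + 1) (hi : i ≤ 1)
    (hG : G + i ≤ r) (h₁ : E₁ + 3 * k ≤ E + k * (2 * q + 2 * i))
    (h₂ : E₂ ≤ E₁ + 2 * k + 2 * G) (hGP : G ≤ P₀ + P₁) (hP : P₀ ≤ P) (hPq : P + 1 ≤ q)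
    (hP₁ : P₁ ≤ Y) (hpp : P₁ = 0 ∨ P ≤ 1)
    (h : 2 ≤ r → E + 4 * q ≤ (2 * q + 1) * r)
    (h' : 2 ≤ r → E + 2 * Y + (2 * q + 1) ≤ (2 * q + 1) * r)
    (h₀ : r ≤ 1 → E = 0) : E₂ + 4 * q ≤ (2 * q + 1) * (r + k + 1) := by
  rcases Nat.lt_or_ge r 2 with hr | hr
  · have := h₀ (by omega)
    interval_cases r <;> interval_cases i <;> first | omega | nlinarith
  · have := h hr
    have := h' hr
    have hki : k * (2 * q + 2 * i) ≤ k * (2 * q + 2 * 1) := by gcongr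
    rcases hpp with hpp | hpp <;> nlinarith

lemma port_of_extension {q r k i G E E₁ Y Z Z' : ℕ} (hq : 4 ≤ q) (hbig : q < r + k) (hi : i ≤ 1)
    (hG : G + i ≤ r)
    (h₁ : E₁ + 2 * Z' + 3 * k ≤ E + k * (2 * q + 2 * i)) (hZ : Z ≤ Y) (hZr : Z ≤ r)
    (h' : 2 ≤ r → E + 2 * Y + (2 * q + 1) ≤ (2 * q + 1) * r)
    (h₀ : r ≤ 1 → E = 0) : E₁ + 2 * (Z + Z') + (2 * q + 1) ≤ (2 * q + 1) * (r + k) := by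
  rcases Nat.lt_or_ge r 2 with hr | hr
  · have := h₀ (by omega)
    interval_cases r <;> interval_cases i <;> first | omega | nlinarith
  · have := h' hr
    interval_cases i <;> nlinarith

/-- The free edges and the port of the hub cost at most 2(q - 1) + 2, within its allowance 2q + 1.
Its other edges use ports of Y that Z no longer counts. -/
lemma port_of_hub_extension {q r k i G E E₁ E₂ Y P P₀ P₁ Z Z' w : ℕ} (hq : 4 ≤ q)
    (hbig : q < r + k + 1) (hi : i ≤ 1)
    (hG : G + i ≤ r) (h₁ : E₁ + 2 * Z' + 3 * k ≤ E + k * (2 * q + 2 * i))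
    (h₂ : E₂ ≤ E₁ + 2 * k + 2 * G) (hGP : G ≤ P₀ + P₁) (hP : P₀ ≤ P) (hPq : P + 1 ≤ q)
    (hP₁ : Z + P₁ ≤ Y) (hZr : Z ≤ r) (hw : w ≤ 1)
    (h' : 2 ≤ r → E + 2 * Y + (2 * q + 1) ≤ (2 * q + 1) * r)
    (h₀ : r ≤ 1 → E = 0) :
    E₂ + 2 * (Z + Z' + w) + (2 * q + 1) ≤ (2 * q + 1) * (r + k + 1) := by
  rcases Nat.lt_or_ge r 2 with hr | hr
  · have := h₀ (by omega)
    interval_cases r <;> interval_cases i <;> first | omega | nlinarith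
  · have := h' hr
    have hki : k * (2 * q + 2 * i) ≤ k * (2 * q + 2 * 1) := by gcongr
    nlinarith

/-- Sparsity is preserved under hub extensions. -/
theorem IsSparse.extend {q : ℕ} (hq : 4 ≤ q) {N X M : Finset ℕ} {g g' ω : ℕ → ℕ → ℕ}
    {y y' p₀ p₁ : ℕ → ℕ} {x x' : ℕ} (hS : IsSparse q N X g y) (hNX : N ⊆ X)
    (hy : ∀ u, y u ≤ 1) (hy' : ∀ u, y' u ≤ 1)
    (h : IsHubExtension q X M g g' ω y y' p₀ p₁ x x') :
    IsSparse q N (insert x' (X ∪ M)) g' y' := by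
  have facts : ∀ R ⊆ X, ∀ T ⊆ M, ∃ i ≤ 1,
      pairSum g' (R ∪ T) + 2 * ∑ u ∈ T, y' u + 3 * T.card ≤
        pairSum g R + T.card * (2 * q + 2 * i) ∧
      ∑ u ∈ R, g' x' u + i ≤ R.card := fun R hR T hT =>
    ⟨if x ∈ R then 1 else 0, by split_ifs <;> simp, h.pairSum_union_le hR hT, h.sum_hub_add_le R⟩
  have hub : ∀ R ⊆ X, ∑ u ∈ R, g' x' u ≤ ∑ u ∈ R, p₀ u + ∑ u ∈ R, p₁ u := fun R hR => by
    rw [← Finset.sum_add_distrib]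
    exact Finset.sum_le_sum fun u hu => h.hub_le u (hR hu)
  have ports : ∀ R ⊆ X, ∑ u ∈ R, y' u + ∑ u ∈ R, p₁ u ≤ ∑ u ∈ R, y u := fun R hR => by
    rw [← Finset.sum_add_distrib]
    exact Finset.sum_le_sum fun u hu => h.port_add_le u (hR hu)
  have hp₀ : ∀ R ⊆ X, ∑ u ∈ R, p₀ u ≤ ∑ u ∈ X, p₀ u := fun R hR =>
    Finset.sum_le_sum_of_subset hR
  have hp₁ : ∀ R ⊆ X, ∑ u ∈ R, p₁ u = 0 ∨ ∑ u ∈ X, p₀ u ≤ 1 := fun R hR => by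
    rcases h.paid with h' | h'
    · exact Or.inl (Finset.sum_eq_zero fun u hu => h' u (hR hu))
    · exact Or.inr h'
  have hsum := h.sum_le
  have hyR : ∀ R : Finset ℕ, ∑ u ∈ R, y u ≤ R.card := fun R => by
    simpa using Finset.sum_le_card_nsmul R y 1 fun u _ => hy u
  have hyR' : ∀ R : Finset ℕ, ∑ u ∈ R, y' u ≤ R.card := fun R => by
    simpa using Finset.sum_le_card_nsmul R y' 1 fun u _ => hy' u
  have hold : ∀ R ⊆ X, R.card ≤ 1 → pairSum g R = 0 := fun R hR hc => by
    have := pairSum_le h.le_one h.loopless R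
    rw [h.pairSum_old hR] at this
    interval_cases R.card <;> omega
  refine ⟨fun S hSX => ?_, fun S hSX hc => ?_, fun S hSX hc => ?_⟩
  · obtain ⟨R, hR, T, hT, hST⟩ := IsHubExtension.subset_cases hSX
    obtain ⟨i, hi, h1, h2⟩ := facts R hR T hT
    have h3 := hub R hR
    have h4 := ports R hR
    have h5 := hp₀ R hR
    have h6 := hS.rooted R hR
    have h7 := h.card_sdiff hNX hR hT
    have h8 := h.pairSum_insert_le hR hT
    have h9 := h.port_hub
    have hki : T.card * i ≤ T.card * 1 := Nat.mul_le_mul_left _ hi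
    simp only [mul_add, add_mul] at h1 h6 ⊢
    rcases hST with rfl | rfl
    · rw [h7.1, Finset.sum_union (h.disj.mono hR hT)]
      simp only [mul_add]
      grind
    · rw [h7.2, h.sum_insert_union hR hT]
      simp only [mul_add]
      grind
  · have hsm := pairSum_le h.le_one h.loopless S
    -- Up to 2q vertices even a complete graph meets the bound; beyond that the extension estimates
    -- apply.
    rcases Nat.lt_or_ge (2 * q) S.card with hbig | hsmall
    swap
    · exact two_of_small hc hsmall hsm
    obtain ⟨R, hR, T, hT, hST⟩ := IsHubExtension.subset_cases hSX
    obtain ⟨i, hi, h1, h2⟩ := facts R hR T hT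
    have h3 := hub R hR
    have h4 := ports R hR
    have h5 := hp₀ R hR
    have h6 := hS.two R hR
    have h6' := hS.port R hR
    have h7 := Finset.card_union_of_disjoint (h.disj.mono hR hT)
    have h7' := h.card_insert_union hR hT
    have h8 := h.pairSum_insert_le hR hT
    have h9 := hp₁ R hR
    have h10 := hold R hR
    have hki : T.card * i ≤ T.card * 1 := Nat.mul_le_mul_left _ hi
    rcases hST with rfl | rfl
    · rw [h7] at hbig ⊢
      exact two_of_extension hbig hi h2 (by omega) h6 h10
    · rw [h7'] at hbig ⊢
      exact two_of_hub_extension hq hbig hi h2 (E₁ := pairSum g' (R ∪ T)) (by omega) h8 h3 h5 hsum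
        (by omega) h9 h6 h6' h10
  · have hsm := pairSum_le h.le_one h.loopless S
    rcases Nat.lt_or_ge q S.card with hbig | hsmall
    swap
    · exact port_of_small hq hc hsmall hsm (hyR' S)
    obtain ⟨R, hR, T, hT, hST⟩ := IsHubExtension.subset_cases hSX
    obtain ⟨i, hi, h1, h2⟩ := facts R hR T hT
    have h4 := ports R hR
    have h6' := hS.port R hR
    have h7 := Finset.card_union_of_disjoint (h.disj.mono hR hT)
    have h7' := h.card_insert_union hR hT
    have h10 := hold R hR
    rcases hST with rfl | rfl
    · rw [h7] at hbig ⊢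
      rw [Finset.sum_union (h.disj.mono hR hT)]
      exact port_of_extension hq hbig hi h2 h1 (by omega) (hyR' R) h6' h10
    · rw [h7'] at hbig ⊢
      rw [h.sum_insert_union hR hT]
      exact port_of_hub_extension hq hbig hi h2 h1 (h.pairSum_insert_le hR hT) (hub R hR) (hp₀ R hR)
        hsum h4 (hyR' R) h.port_hub h6' h10

/-! ### Covered pairs and ports of a family of cliques -/

/-- The number of members of `D` that contain both `u` and `v`. -/
def cov (D : Multiset (Finset ℕ)) (u v : ℕ) : ℕ := D.countP fun K => u ∈ K ∧ v ∈ K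

/-- The number of members of `D` with at least two vertices in `N` that contain `w ∉ N`. -/
def port (N : Finset ℕ) (D : Multiset (Finset ℕ)) (w : ℕ) : ℕ :=
  D.countP fun K => w ∈ K ∧ w ∉ N ∧ 2 ≤ (K ∩ N).card

/-- The multiplicity with which `D` covers the pairs that are not inside `N`. -/
def adjOf (N : Finset ℕ) (D : Multiset (Finset ℕ)) (u v : ℕ) : ℕ :=
  if u ≠ v ∧ ¬ (u ∈ N ∧ v ∈ N) then cov D u v else 0

@[simp] lemma cov_add (D E : Multiset (Finset ℕ)) (u v : ℕ) :
    cov (D + E) u v = cov D u v + cov E u v := Multiset.countP_add _ _ _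

@[simp] lemma port_add (N : Finset ℕ) (D E : Multiset (Finset ℕ)) (w : ℕ) :
    port N (D + E) w = port N D w + port N E w := Multiset.countP_add _ _ _

lemma cov_comm (D : Multiset (Finset ℕ)) (u v : ℕ) : cov D u v = cov D v u := by
  unfold cov; congr 1; ext K; exact and_comm

@[simp] lemma cov_singleton (K : Finset ℕ) (u v : ℕ) :
    cov {K} u v = if u ∈ K ∧ v ∈ K then 1 else 0 := by
  rw [cov, ← Multiset.cons_zero, Multiset.countP_cons, Multiset.countP_zero, zero_add]

@[simp] lemma port_singleton (N K : Finset ℕ) (w : ℕ) :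
    port N {K} w = if w ∈ K ∧ w ∉ N ∧ 2 ≤ (K ∩ N).card then 1 else 0 := by
  rw [port, ← Multiset.cons_zero, Multiset.countP_cons, Multiset.countP_zero, zero_add]

lemma cov_eq_zero {D : Multiset (Finset ℕ)} {X : Finset ℕ} (h : ∀ K ∈ D, K ⊆ X) {u v : ℕ}
    (hu : u ∉ X) : cov D u v = 0 :=
  Multiset.countP_eq_zero.2 fun K hK hh => hu (h K hK hh.1)

lemma port_eq_zero {N X : Finset ℕ} {D : Multiset (Finset ℕ)} (h : ∀ K ∈ D, K ⊆ X) {u : ℕ}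
    (hu : u ∉ X) : port N D u = 0 :=
  Multiset.countP_eq_zero.2 fun K hK hh => hu (h K hK hh.1)

lemma adjOf_comm (N : Finset ℕ) (D : Multiset (Finset ℕ)) (u v : ℕ) :
    adjOf N D u v = adjOf N D v u := by
  unfold adjOf
  rw [cov_comm D u v]
  simp only [ne_comm (a := u), and_comm (a := u ∈ N)]

lemma adjOf_le_cov (N : Finset ℕ) (D : Multiset (Finset ℕ)) (u v : ℕ) :
    adjOf N D u v ≤ cov D u v := by
  unfold adjOf; split_ifs <;> simp

/-! ### Rows and columns indexed by (ZMod 3)^ι -/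

section Points

variable {ι : Type} [DecidableEq ι]

/-- The column of a point `(a, s)`; its row is `a`. -/
def colOf (p : (ι → ZMod 3) × ι) : ι → ZMod 3 := p.1 + Pi.single p.2 1

lemma single_one_injective :
    Function.Injective fun s : ι => (Pi.single s 1 : ι → ZMod 3) := by
  intro s t h
  by_contra hst
  have h' := congrFun h s
  simp only [Pi.single_eq_same, Pi.single_eq_of_ne hst] at h'
  exact absurd h' (by decide)

lemma colOf_injOn_row {p p' : (ι → ZMod 3) × ι} (h₁ : p.1 = p'.1) (h₂ : colOf p = colOf p') :
    p = p' := by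
  rcases p with ⟨a, s⟩
  rcases p' with ⟨b, t⟩
  obtain rfl : a = b := h₁
  obtain rfl : s = t := single_one_injective (add_left_cancel h₂)
  rfl

/-- At coordinate s the left side is 1 or 2, nonzero modulo 3, so s is u or v. Modulo 2 this fails
for s = t and u = v; it is the reason for ZMod 3, as it excludes 4-cycles in the incidence of rows
and columns. -/
lemma single_add_single {s t u v : ι}
    (h : (Pi.single s 1 + Pi.single t 1 : ι → ZMod 3) = Pi.single u 1 + Pi.single v 1) :
    (s = u ∧ t = v) ∨ (s = v ∧ t = u) := by
  by_cases hu : s = u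
  · subst hu
    exact Or.inl ⟨rfl, single_one_injective (add_left_cancel h)⟩
  by_cases hv : s = v
  · subst hv
    rw [add_comm (Pi.single u 1)] at h
    exact Or.inr ⟨rfl, single_one_injective (add_left_cancel h)⟩
  have h' := congrFun h s
  simp only [Pi.add_apply, Pi.single_eq_same, Pi.single_eq_of_ne hu, Pi.single_eq_of_ne hv] at h'
  by_cases ht : s = t
  · subst ht
    rw [Pi.single_eq_same] at h'
    exact absurd h' (by decide)
  · rw [Pi.single_eq_of_ne ht] at h'
    exact absurd h' (by decide)

/-- A row other than the zero row meets at most one column through the zero row. -/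
lemma eq_of_colOf_eq_single {p p' : (ι → ZMod 3) × ι} {t t' : ι} (hp : p.1 ≠ 0)
    (hpp : p.1 = p'.1) (h : colOf p = Pi.single t 1) (h' : colOf p' = Pi.single t' 1) :
    p = p' := by
  rcases p with ⟨a, s⟩
  rcases p' with ⟨b, s'⟩
  obtain rfl : a = b := hpp
  simp only [colOf] at h h'
  have h1 : (Pi.single t 1 + Pi.single s' 1 : ι → ZMod 3) = Pi.single t' 1 + Pi.single s 1 := by
    rw [← h, ← h']; abel
  rcases single_add_single h1 with ⟨-, rfl⟩ | ⟨rfl, -⟩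
  · rfl
  · exact absurd (add_eq_right.1 h) hp

end Points

/-! ### Trades -/

section Trade

variable {ι : Type} [Fintype ι] [DecidableEq ι]

/-- The points on the line with index `a`, where `idx` is the row or the column index. -/
def block (φ : (ι → ZMod 3) × ι → ℕ) (idx : (ι → ZMod 3) × ι → ι → ZMod 3) (a : ι → ZMod 3) :
    Finset ℕ := (Finset.univ.filter fun p => idx p = a).image φ

/-- All lines of one direction, joined to the vertex `x`. -/
def fan (φ : (ι → ZMod 3) × ι → ℕ) (idx : (ι → ZMod 3) × ι → ι → ZMod 3) (x : ℕ) :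
    Multiset (Finset ℕ) := Finset.univ.val.map fun a => insert x (block φ idx a)

variable {φ : (ι → ZMod 3) × ι → ℕ} {idx : (ι → ZMod 3) × ι → ι → ZMod 3} {x x' : ℕ}

lemma mem_block (hφ : φ.Injective) {p : (ι → ZMod 3) × ι} {a : ι → ZMod 3} :
    φ p ∈ block φ idx a ↔ idx p = a := by
  simp [block, hφ.eq_iff]

lemma exists_of_mem_block {u : ℕ} {a : ι → ZMod 3} (h : u ∈ block φ idx a) :
    ∃ p, idx p = a ∧ φ p = u := by
  simpa [block] using h

lemma cov_fan (u v : ℕ) : cov (fan φ idx x) u v =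
    (Finset.univ.filter fun a => u ∈ insert x (block φ idx a) ∧
      v ∈ insert x (block φ idx a)).card := by
  rw [cov, fan, Multiset.countP_map]; rfl

lemma port_fan (N : Finset ℕ) (w : ℕ) : port N (fan φ idx x) w =
    (Finset.univ.filter fun a => w ∈ insert x (block φ idx a) ∧ w ∉ N ∧
      2 ≤ (insert x (block φ idx a) ∩ N).card).card := by
  rw [port, fan, Multiset.countP_map]; rfl

lemma cov_fan_pt (hφ : φ.Injective) (hx : ∀ p, φ p ≠ x) (p p' : (ι → ZMod 3) × ι) :
    cov (fan φ idx x) (φ p) (φ p') = if idx p = idx p' then 1 else 0 := by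
  simp only [cov_fan, Finset.mem_insert, hx, false_or, mem_block hφ]
  split_ifs with h
  · simp [h, Finset.filter_eq]
  · rw [Finset.card_eq_zero, Finset.filter_eq_empty_iff]
    rintro a - ⟨h1, h2⟩
    exact h (h1.trans h2.symm)

lemma cov_fan_hub (hφ : φ.Injective) (hx : ∀ p, φ p ≠ x) (p : (ι → ZMod 3) × ι) :
    cov (fan φ idx x) x (φ p) = 1 := by
  simp [cov_fan, hx, mem_block hφ, Finset.filter_eq]

lemma cov_fan_other {u v : ℕ} (hu : u ≠ x) (hu' : ∀ p, φ p ≠ u) :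
    cov (fan φ idx x) u v = 0 := by
  rw [cov_fan, Finset.card_eq_zero, Finset.filter_eq_empty_iff]
  rintro a - ⟨h1, -⟩
  rcases Finset.mem_insert.1 h1 with h1 | h1
  · exact hu h1
  · obtain ⟨p, -, hp⟩ := exists_of_mem_block h1
    exact hu' p hp

/-- The two sides of a trade have the same shape, with the hubs exchanged. -/
def trade (φ : (ι → ZMod 3) × ι → ℕ) (x x' : ℕ) : Multiset (Finset ℕ) :=
  fan φ Prod.fst x + fan φ colOf x'

lemma cov_trade_pt (hφ : φ.Injective) (hx : ∀ p, φ p ≠ x) (hx' : ∀ p, φ p ≠ x')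
    (p p' : (ι → ZMod 3) × ι) : cov (trade φ x x') (φ p) (φ p') =
      (if p.1 = p'.1 then 1 else 0) + if colOf p = colOf p' then 1 else 0 := by
  rw [trade, cov_add, cov_fan_pt hφ hx, cov_fan_pt hφ hx']

lemma cov_trade_hub (hφ : φ.Injective) (hx : ∀ p, φ p ≠ x) (hxx : x ≠ x')
    (p : (ι → ZMod 3) × ι) : cov (trade φ x x') x (φ p) = 1 := by
  rw [trade, cov_add, cov_fan_hub hφ hx, cov_fan_other hxx hx]

lemma cov_trade_hub' (hφ : φ.Injective) (hx' : ∀ p, φ p ≠ x') (hxx : x ≠ x')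
    (p : (ι → ZMod 3) × ι) : cov (trade φ x x') x' (φ p) = 1 := by
  rw [trade, cov_add, cov_fan_hub hφ hx', cov_fan_other hxx.symm hx']

lemma cov_trade_hubs (hx : ∀ p, φ p ≠ x) (hx' : ∀ p, φ p ≠ x') (hxx : x ≠ x') :
    cov (trade φ x x') x x' = 0 := by
  rw [trade, cov_add, cov_comm, cov_fan_other hxx.symm hx', cov_fan_other hxx hx]

lemma cov_trade_other {u v : ℕ} (hu : u ≠ x) (hu' : u ≠ x') (hu'' : ∀ p, φ p ≠ u) :
    cov (trade φ x x') u v = 0 := by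
  rw [trade, cov_add, cov_fan_other hu hu'', cov_fan_other hu' hu'']

lemma trade_cases (φ : (ι → ZMod 3) × ι → ℕ) (x x' u : ℕ) :
    u = x ∨ u = x' ∨ (∃ p, φ p = u) ∨ (u ≠ x ∧ u ≠ x' ∧ ∀ p, φ p ≠ u) := by
  by_cases h : ∃ p, φ p = u
  · tauto
  · push Not at h; tauto

/-- On either side each hub meets each point once, the hubs never meet each other, and pairs of
points only see rows and columns. -/
lemma cov_trade_swap (hφ : φ.Injective) (hx : ∀ p, φ p ≠ x) (hx' : ∀ p, φ p ≠ x') (hxx : x ≠ x')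
    {u v : ℕ} (huv : u ≠ v) : cov (trade φ x x') u v = cov (trade φ x' x) u v := by
  rcases trade_cases φ x x' u with rfl | rfl | ⟨p, rfl⟩ | ⟨h1, h2, h3⟩
  · rcases trade_cases φ u x' v with rfl | rfl | ⟨p, rfl⟩ | ⟨h1, h2, h3⟩
    · exact absurd rfl huv
    · rw [cov_trade_hubs hx hx' hxx, cov_comm, cov_trade_hubs hx' hx hxx.symm]
    · rw [cov_trade_hub hφ hx hxx, cov_trade_hub' hφ hx hxx.symm]
    · rw [cov_comm, cov_trade_other h1 h2 h3, cov_comm, cov_trade_other h2 h1 h3]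
  · rcases trade_cases φ x u v with rfl | rfl | ⟨p, rfl⟩ | ⟨h1, h2, h3⟩
    · rw [cov_comm, cov_trade_hubs hx hx' hxx, cov_trade_hubs hx' hx hxx.symm]
    · exact absurd rfl huv
    · rw [cov_trade_hub hφ hx' hxx.symm, cov_trade_hub' hφ hx' hxx]
    · rw [cov_comm, cov_trade_other h1 h2 h3, cov_comm, cov_trade_other h2 h1 h3]
  · rcases trade_cases φ x x' v with rfl | rfl | ⟨p', rfl⟩ | ⟨h1, h2, h3⟩
    · rw [cov_comm, cov_trade_hub hφ hx hxx, cov_comm, cov_trade_hub' hφ hx hxx.symm]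
    · rw [cov_comm, cov_trade_hub' hφ hx' hxx, cov_comm, cov_trade_hub hφ hx' hxx.symm]
    · rw [cov_trade_pt hφ hx hx', cov_trade_pt hφ hx' hx]
    · rw [cov_comm, cov_trade_other h1 h2 h3, cov_comm, cov_trade_other h2 h1 h3]
  · rw [cov_trade_other h1 h2 h3, cov_trade_other h2 h1 h3]

lemma cov_trade_pt_le (hφ : φ.Injective) (hx : ∀ p, φ p ≠ x) (hx' : ∀ p, φ p ≠ x')
    {p p' : (ι → ZMod 3) × ι} (h : p ≠ p') : cov (trade φ x x') (φ p) (φ p') ≤ 1 := by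
  rw [cov_trade_pt hφ hx hx']
  split_ifs with h1 h2 <;> first | exact absurd (colOf_injOn_row h1 h2) h | simp

lemma cov_trade_le (hφ : φ.Injective) (hx : ∀ p, φ p ≠ x) (hx' : ∀ p, φ p ≠ x') (hxx : x ≠ x')
    {u v : ℕ} (huv : u ≠ v) : cov (trade φ x x') u v ≤ 1 := by
  have hub : ∀ w, w ≠ x → cov (trade φ x x') x w ≤ 1 := fun w hw => by
    rcases trade_cases φ x x' w with rfl | rfl | ⟨p, rfl⟩ | ⟨h1, h2, h3⟩
    · exact absurd rfl hw
    · simp [cov_trade_hubs hx hx' hxx]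
    · simp [cov_trade_hub hφ hx hxx]
    · simp [cov_comm _ x w, cov_trade_other h1 h2 h3]
  have hub' : ∀ w, w ≠ x' → cov (trade φ x x') x' w ≤ 1 := fun w hw => by
    rcases trade_cases φ x x' w with rfl | rfl | ⟨p, rfl⟩ | ⟨h1, h2, h3⟩
    · simp [cov_comm _ x' w, cov_trade_hubs hx hx' hxx]
    · exact absurd rfl hw
    · simp [cov_trade_hub' hφ hx' hxx]
    · simp [cov_comm _ x' w, cov_trade_other h1 h2 h3]
  rcases trade_cases φ x x' u with rfl | rfl | ⟨p, rfl⟩ | ⟨h1, h2, h3⟩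
  · exact hub v huv.symm
  · exact hub' v huv.symm
  · rcases trade_cases φ x x' v with rfl | rfl | ⟨p', rfl⟩ | ⟨h1, h2, h3⟩
    · rw [cov_comm]; exact hub _ huv
    · rw [cov_comm]; exact hub' _ huv
    · exact cov_trade_pt_le hφ hx hx' fun h => huv (h ▸ rfl)
    · simp [cov_comm _ (φ p) v, cov_trade_other h1 h2 h3]
  · simp [cov_trade_other h1 h2 h3]

lemma card_line_fst (a : ι → ZMod 3) :
    (Finset.univ.filter fun p : (ι → ZMod 3) × ι => p.1 = a).card = Fintype.card ι := by
  rw [← Finset.card_univ]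
  refine Finset.card_bij (fun p _ => p.2) (by simp) ?_ ?_
  · rintro ⟨b, s⟩ h ⟨c, t⟩ h' hst
    simp_all
  · intro s _
    exact ⟨(a, s), by simp⟩

lemma card_line_colOf (a : ι → ZMod 3) :
    (Finset.univ.filter fun p : (ι → ZMod 3) × ι => colOf p = a).card = Fintype.card ι := by
  rw [← Finset.card_univ]
  refine Finset.card_bij (fun p _ => p.2) (by simp) ?_ ?_
  · rintro ⟨b, s⟩ h ⟨c, t⟩ h' hst
    rw [Finset.mem_filter_univ] at h h'
    obtain rfl : s = t := hst
    rw [← h'] at h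
    rw [show b = c from add_right_cancel h]
  · intro s _
    exact ⟨(a - Pi.single s 1, s), by rw [Finset.mem_filter_univ]; simp [colOf], rfl⟩

lemma block_subset (a : ι → ZMod 3) : block φ idx a ⊆ Finset.univ.image φ :=
  Finset.image_subset_image (Finset.subset_univ _)

lemma mem_fan {K : Finset ℕ} : K ∈ fan φ idx x ↔ ∃ a, insert x (block φ idx a) = K := by
  simp [fan]

lemma card_of_mem_trade (hφ : φ.Injective) (hx : ∀ p, φ p ≠ x) (hx' : ∀ p, φ p ≠ x')
    {K : Finset ℕ} (hK : K ∈ trade φ x x') : K.card = Fintype.card ι + 1 := by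
  rcases Multiset.mem_add.1 hK with h | h
  all_goals
    obtain ⟨a, rfl⟩ := mem_fan.1 h
    rw [Finset.card_insert_of_notMem]
    · rw [block, Finset.card_image_of_injective _ hφ]
      first | rw [card_line_fst] | rw [card_line_colOf]
    · intro h'
      obtain ⟨p, -, hp⟩ := exists_of_mem_block h'
      first | exact hx p hp | exact hx' p hp

lemma subset_of_mem_trade {K : Finset ℕ} (hK : K ∈ trade φ x x') :
    K ⊆ insert x (insert x' (Finset.univ.image φ)) := by
  rcases Multiset.mem_add.1 hK with h | h
  all_goals
    obtain ⟨a, rfl⟩ := mem_fan.1 h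
    refine Finset.insert_subset (by simp) ?_
    refine (block_subset a).trans ?_
    intro u hu
    simp only [Finset.mem_insert]
    tauto

end Trade

/-! ### Balanced pairs and exchange along a trade -/

/-- A pair `D₁`, `D₂` of collections of `q`-sets that cover the pairs outside `N` equally often and
at most once, where the covered pairs form a sparse graph. -/
structure IsBalancedPair (q : ℕ) (N X : Finset ℕ) (D₁ D₂ : Multiset (Finset ℕ)) : Prop where
  base : N ⊆ X
  sub : ∀ K ∈ D₁ + D₂, K ⊆ X
  card_eq : ∀ K ∈ D₁ + D₂, K.card = q
  bal : ∀ u v, u ≠ v → ¬ (u ∈ N ∧ v ∈ N) → cov D₁ u v = cov D₂ u v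
  le_one : ∀ u v, u ≠ v → ¬ (u ∈ N ∧ v ∈ N) → cov D₁ u v ≤ 1
  port_le : ∀ w, port N (D₁ + D₂) w ≤ 1
  sparse : IsSparse q N X (adjOf N D₁) (port N (D₁ + D₂))

lemma IsBalancedPair.sub₁ {q : ℕ} {N X : Finset ℕ} {D₁ D₂ : Multiset (Finset ℕ)}
    (h : IsBalancedPair q N X D₁ D₂) : ∀ K ∈ D₁, K ⊆ X :=
  fun K hK => h.sub K (Multiset.mem_add.2 (Or.inl hK))

lemma IsBalancedPair.sub₂ {q : ℕ} {N X : Finset ℕ} {D₁ D₂ : Multiset (Finset ℕ)}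
    (h : IsBalancedPair q N X D₁ D₂) : ∀ K ∈ D₂, K ⊆ X :=
  fun K hK => h.sub K (Multiset.mem_add.2 (Or.inr hK))

theorem IsBalancedPair.symm {q : ℕ} {N X : Finset ℕ} {D₁ D₂ : Multiset (Finset ℕ)}
    (h : IsBalancedPair q N X D₁ D₂) : IsBalancedPair q N X D₂ D₁ where
  base := h.base
  sub := by rw [add_comm]; exact h.sub
  card_eq := by rw [add_comm]; exact h.card_eq
  bal u v huv hN := (h.bal u v huv hN).symm
  le_one u v huv hN := by rw [← h.bal u v huv hN]; exact h.le_one u v huv hN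
  port_le := by rw [add_comm]; exact h.port_le
  sparse := by
    have h1 : adjOf N D₂ = adjOf N D₁ := by
      funext u v
      unfold adjOf
      split_ifs with huv
      · exact (h.bal u v huv.1 huv.2).symm
      · rfl
    rw [add_comm, h1]
    exact h.sparse

/-- Exchanging along a trade whose points are partly old and partly new. The new points are
oriented by `ω`. -/
theorem IsBalancedPair.exchange {q : ℕ} (hq : 4 ≤ q) {N X : Finset ℕ}
    {D₁ D₂ D₁' D₂' Z : Multiset (Finset ℕ)} (h : IsBalancedPair q N X D₁ D₂)
    {ι : Type} [Fintype ι] [DecidableEq ι] (hι : Fintype.card ι + 1 = q)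
    {φ : (ι → ZMod 3) × ι → ℕ} (hφ : φ.Injective) {x x' : ℕ} (hx : ∀ p, φ p ≠ x)
    (hx' : ∀ p, φ p ≠ x') (hxX : x ∈ X) (hxX' : x' ∉ X)
    (hZ₁ : D₁' + Z = D₁ + trade φ x x') (hZ₂ : D₂' + Z = D₂ + trade φ x' x)
    (hZX : ∀ K ∈ Z, K ⊆ X)
    (hcov : ∀ u ∈ X, ∀ v ∈ X, u ≠ v → ¬ (u ∈ N ∧ v ∈ N) → cov (trade φ x x') u v = cov Z u v)
    (ω : (ι → ZMod 3) × ι → (ι → ZMod 3) × ι → ℕ)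
    (hω_new : ∀ p p', φ p ∉ X → φ p' ∉ X → p ≠ p' → (p.1 = p'.1 ∨ colOf p = colOf p') →
      2 ≤ ω p p' + ω p' p)
    (hω_root : ∀ p p', φ p ∉ X → φ p' ∈ X → (p.1 = p'.1 ∨ colOf p = colOf p') → 2 ≤ ω p p')
    (hω_sum : ∀ p, φ p ∉ X → ∑ p', ω p p' + 2 * port N (D₁' + D₂') (φ p) + 3 ≤ 2 * q)
    (p₀ p₁ : ℕ → ℕ)
    (hport : ∀ u ∈ X, port N (D₁' + D₂') u + p₁ u ≤ port N (D₁ + D₂) u)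
    (hport' : ∀ u, u ∉ X → port N (D₁' + D₂') u ≤ 1)
    (hhub : ∀ p, φ p ∈ X → 1 ≤ p₀ (φ p) + p₁ (φ p))
    (hsum : ∑ u ∈ X, p₀ u + 1 ≤ q) (hpp : (∀ u ∈ X, p₁ u = 0) ∨ ∑ u ∈ X, p₀ u ≤ 1) :
    IsBalancedPair q N (insert x' (X ∪ Finset.univ.image φ \ X)) D₁' D₂' := by
  have hxx : x ≠ x' := fun hh => hxX' (hh ▸ hxX)
  have hι' : Nonempty ι := Fintype.card_pos_iff.1 (by omega)
  have hc₁ : ∀ u v, cov D₁' u v + cov Z u v = cov D₁ u v + cov (trade φ x x') u v := fun u v => by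
    rw [← cov_add, ← cov_add, hZ₁]
  have hc₂ : ∀ u v, cov D₂' u v + cov Z u v = cov D₂ u v + cov (trade φ x' x) u v := fun u v => by
    rw [← cov_add, ← cov_add, hZ₂]
  have hnew : ∀ u v, u ∉ X → cov D₁' u v = cov (trade φ x x') u v := fun u v hu => by
    have := hc₁ u v
    rw [cov_eq_zero hZX hu, cov_eq_zero h.sub₁ hu] at this
    omega
  have hnew' : ∀ u v, v ∉ X → cov D₁' u v = cov (trade φ x x') u v := fun u v hv => by
    rw [cov_comm, hnew v u hv, cov_comm]
  -- Within X, outside N, the trade covers just what Z covers; removing Z therefore leaves the old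
  -- graph unchanged there.
  have hold : ∀ u ∈ X, ∀ v ∈ X, u ≠ v → ¬ (u ∈ N ∧ v ∈ N) → cov D₁' u v = cov D₁ u v :=
    fun u hu v hv huv hN => by
      have h1 := hc₁ u v
      have h2 := hcov u hu v hv huv hN
      omega
  have hbal : ∀ u v, u ≠ v → ¬ (u ∈ N ∧ v ∈ N) → cov D₁' u v = cov D₂' u v := by
    intro u v huv hN
    have h1 := hc₁ u v
    have h2 := hc₂ u v
    have h3 := cov_trade_swap hφ hx hx' hxx huv
    have h4 := h.bal u v huv hN
    omega
  have hle : ∀ u v, u ≠ v → ¬ (u ∈ N ∧ v ∈ N) → cov D₁' u v ≤ 1 := by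
    intro u v huv hN
    by_cases hu : u ∈ X
    · by_cases hv : v ∈ X
      · rw [hold u hu v hv huv hN]
        exact h.le_one u v huv hN
      · rw [hnew' u v hv]
        exact cov_trade_le hφ hx hx' hxx huv
    · rw [hnew u v hu]
      exact cov_trade_le hφ hx hx' hxx huv
  have hadj_le : ∀ u v, adjOf N D₁' u v ≤ 1 := by
    intro u v
    unfold adjOf
    split_ifs with huv
    · exact hle u v huv.1 huv.2
    · simp
  have hadj_loop : ∀ (D : Multiset (Finset ℕ)) u, adjOf N D u u = 0 := fun D u => by simp [adjOf]
  have hportle : ∀ u, port N (D₁' + D₂') u ≤ 1 := by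
    intro u
    by_cases hu : u ∈ X
    · have h1 := hport u hu
      have h2 := h.port_le u
      omega
    · exact hport' u hu
  set M := Finset.univ.image φ \ X with hMdef
  have hM : ∀ u ∈ M, u ∉ X ∧ ∃ p, φ p = u := by
    intro u hu
    rw [hMdef, Finset.mem_sdiff, Finset.mem_image] at hu
    obtain ⟨⟨p, -, hp⟩, hX⟩ := hu
    exact ⟨hX, p, hp⟩
  have hbig : ∀ K ∈ (D₁ + D₂) + (trade φ x x' + trade φ x' x),
      K ⊆ insert x' (X ∪ M) ∧ K.card = q := by
    intro K hK
    have hsubt : insert x (insert x' (Finset.univ.image φ)) ⊆ insert x' (X ∪ M) := by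
      intro u hu
      simp only [hMdef, Finset.mem_insert, Finset.mem_union, Finset.mem_sdiff] at hu ⊢
      by_cases hX : u ∈ X
      · tauto
      · rcases hu with rfl | hu
        · exact absurd hxX hX
        · tauto
    rcases Multiset.mem_add.1 hK with hK | hK
    · refine ⟨(h.sub K hK).trans ?_, h.card_eq K hK⟩
      intro u hu
      simp [hu]
    · rcases Multiset.mem_add.1 hK with hK | hK
      · exact ⟨(subset_of_mem_trade hK).trans hsubt, by rw [card_of_mem_trade hφ hx hx' hK, hι]⟩
      · refine ⟨(subset_of_mem_trade hK).trans ?_, by rw [card_of_mem_trade hφ hx' hx hK, hι]⟩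
        rw [Finset.insert_comm]
        exact hsubt
  have hmem : ∀ K ∈ D₁' + D₂', K ∈ (D₁ + D₂) + (trade φ x x' + trade φ x' x) := by
    intro K hK
    have : (D₁ + D₂) + (trade φ x x' + trade φ x' x) = (D₁' + D₂') + (Z + Z) := by
      rw [add_add_add_comm, ← hZ₁, ← hZ₂, add_add_add_comm]
    rw [this]
    exact Multiset.mem_add.2 (Or.inl hK)
  refine
    { base := fun u hu => Finset.mem_insert_of_mem (Finset.mem_union_left _ (h.base hu))
      sub := fun K hK => (hbig K (hmem K hK)).1
      card_eq := fun K hK => (hbig K (hmem K hK)).2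
      bal := hbal
      le_one := hle
      port_le := hportle
      sparse := ?_ }
  have hinv : ∀ p, Function.invFun φ (φ p) = p := Function.leftInverse_invFun hφ
  -- The orientation is carried from points to vertices. Vertices that are not points get weight 0:
  -- among those in X, new points are adjacent only to x, which is accounted for separately.
  refine h.sparse.extend (ω := fun u v => if v ∈ Finset.univ.image φ then
      ω (Function.invFun φ u) (Function.invFun φ v) else 0) (p₀ := p₀) (p₁ := p₁) (x := x)
      hq h.base h.port_le hportle ?_
  refine
    { hub_mem := hxX
      hub_notMem := hxX'
      disj := Finset.disjoint_sdiff
      hub_notMem_new := fun hh => ?_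
      old := fun u hu v hv => ?_
      symm := adjOf_comm _ _
      le_one := hadj_le
      loopless := hadj_loop _
      hubs := ?_
      root := fun u hu v hv hvx => ?_
      new := fun u hu v hv => ?_
      out_le := fun u hu => ?_
      hub_le := fun u hu => ?_
      port_add_le := hport
      port_hub := hportle x'
      sum_le := hsum
      paid := hpp }
  · obtain ⟨-, p, hp⟩ := hM x' hh
    exact hx' p hp
  · unfold adjOf
    split_ifs with huv
    · exact hold u hu v hv huv.1 huv.2
    · rfl
  · have := adjOf_le_cov N D₁' x' x
    rw [hnew x' x hxX', cov_comm, cov_trade_hubs hx hx' hxx] at this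
    omega
  · obtain ⟨hu, p, rfl⟩ := hM u hu
    have h1 := adjOf_le_cov N D₁' (φ p) v
    rw [hnew _ _ hu] at h1
    rcases trade_cases φ x x' v with rfl | rfl | ⟨p', rfl⟩ | ⟨h2, h3, h4⟩
    · exact absurd rfl hvx
    · exact absurd hv hxX'
    · have hpp' : p ≠ p' := by
        rintro rfl
        exact hu hv
      rw [if_pos (Finset.mem_image_of_mem _ (Finset.mem_univ _)), hinv, hinv]
      have h5 := hadj_le (φ p) (φ p')
      by_cases hs : p.1 = p'.1 ∨ colOf p = colOf p'
      · have := hω_root p p' hu hv hs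
        omega
      · rw [not_or] at hs
        rw [cov_trade_pt hφ hx hx', if_neg hs.1, if_neg hs.2] at h1
        omega
    · rw [cov_comm, cov_trade_other h2 h3 h4] at h1
      omega
  · obtain ⟨hu, p, rfl⟩ := hM u hu
    obtain ⟨hv, p', rfl⟩ := hM v hv
    simp only [if_pos (Finset.mem_image_of_mem φ (Finset.mem_univ _)), hinv]
    rcases eq_or_ne p p' with rfl | hpp'
    · simp [hadj_loop]
    have h1 := adjOf_le_cov N D₁' (φ p) (φ p')
    rw [hnew _ _ hu] at h1
    have h5 := hadj_le (φ p) (φ p')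
    by_cases hs : p.1 = p'.1 ∨ colOf p = colOf p'
    · have := hω_new p p' hu hv hpp' hs
      omega
    · rw [not_or] at hs
      rw [cov_trade_pt hφ hx hx', if_neg hs.1, if_neg hs.2] at h1
      omega
  · obtain ⟨hu, p, rfl⟩ := hM u hu
    have h1 := hω_sum p hu
    rw [hinv, ← Finset.sum_filter]
    have h2 : ∑ v ∈ ((X ∪ M).erase x).filter (· ∈ Finset.univ.image φ),
        ω p (Function.invFun φ v) ≤ ∑ v ∈ Finset.univ.image φ, ω p (Function.invFun φ v) :=
      Finset.sum_le_sum_of_subset fun v hv => (Finset.mem_filter.1 hv).2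
    rw [Finset.sum_image fun a _ b _ hab => hφ hab] at h2
    simp only [hinv] at h2
    omega
  · rcases trade_cases φ x x' u with rfl | rfl | ⟨p, rfl⟩ | ⟨h2, h3, h4⟩
    · have := adjOf_le_cov N D₁' x' u
      rw [hnew x' u hxX', cov_comm, cov_trade_hubs hx hx' hxx] at this
      omega
    · exact absurd hu hxX'
    · have := hhub p hu
      have := hadj_le x' (φ p)
      omega
    · have := adjOf_le_cov N D₁' x' u
      rw [hnew x' u hxX', cov_comm, cov_trade_other h2 h3 h4] at this
      omega

lemma exists_fresh (X : Finset ℕ) (τ : Type) [Finite τ] :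
    ∃ ψ : τ → ℕ, ψ.Injective ∧ ∀ t, ψ t ∉ X := by
  obtain ⟨n, ⟨e⟩⟩ := Finite.exists_equiv_fin τ
  refine ⟨fun t => X.sup id + 1 + e t, fun s t h => ?_, fun t ht => ?_⟩
  · exact e.injective (Fin.ext (by simpa using h))
  · have : X.sup id + 1 + e t ≤ X.sup id := Finset.le_sup (f := id) ht
    omega

lemma colOf_of_fst_eq_zero {ι : Type} [DecidableEq ι] {p : (ι → ZMod 3) × ι} (h : p.1 = 0) :
    colOf p = Pi.single p.2 1 := by
  simp [colOf, h]

/-! ### Fractional orientation when only the zero row is old -/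

section Orientation

variable {ι : Type} [Fintype ι] [DecidableEq ι]

lemma card_line_fst_ne (p : (ι → ZMod 3) × ι) :
    (Finset.univ.filter fun p' => p' ≠ p ∧ p'.1 = p.1).card + 1 = Fintype.card ι := by
  have h := Finset.card_erase_add_one (s := Finset.univ.filter fun p' => p'.1 = p.1) (a := p) (by simp)
  rw [card_line_fst] at h
  rw [← h]
  congr 2
  ext p'
  simp

lemma card_line_colOf_ne (p : (ι → ZMod 3) × ι) :
    (Finset.univ.filter fun p' => p' ≠ p ∧ colOf p' = colOf p).card + 1 = Fintype.card ι := by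
  have h := Finset.card_erase_add_one (s := Finset.univ.filter fun p' => colOf p' = colOf p) (a := p) (by simp)
  rw [card_line_colOf] at h
  rw [← h]
  congr 2
  ext p'
  simp

lemma card_filter_le_one {α : Type*} [Fintype α] {P : α → Prop} [DecidablePred P]
    (h : ∀ a b, P a → P b → a = b) : (Finset.univ.filter P).card ≤ 1 := by
  rw [Finset.card_le_one]
  intro a ha b hb
  exact h a b (Finset.mem_filter.1 ha).2 (Finset.mem_filter.1 hb).2

open Classical in
/-- The orientation used when only the zero row is old: a point on a column through the zero row
does not own any row pair. -/
noncomputable def rowOrientation (p p' : (ι → ZMod 3) × ι) : ℕ :=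
  if p' = p then 0 else
  if colOf p' = colOf p then (if p'.1 = 0 then 2 else 1) else
  if p'.1 = p.1 then
    (if ∃ t, colOf p = Pi.single t 1 then 0 else if ∃ t, colOf p' = Pi.single t 1 then 2 else 1)
  else 0

/-- The column has `Fintype.card ι - 1` other points of weight 1, and its point in the zero row
costs one more. The row pairs are owned by the other points of the row, which leaves room for a
port. -/
lemma rowOrientation_sum_rooted {p : (ι → ZMod 3) × ι}
    (hr : ∃ t, colOf p = Pi.single t 1) :
    ∑ p', rowOrientation p p' ≤ Fintype.card ι := by
  classical
  have h1 : ∀ p', rowOrientation p p' ≤ (if p' ≠ p ∧ colOf p' = colOf p then 1 else 0) +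
      (if p'.1 = 0 ∧ colOf p' = colOf p then 1 else 0) := by
    intro p'
    unfold rowOrientation
    split_ifs <;> simp_all
  have h2 := Finset.sum_le_sum fun p' (_ : p' ∈ Finset.univ) => h1 p'
  rw [Finset.sum_add_distrib, Finset.sum_boole, Finset.sum_boole] at h2
  have h3 := card_line_colOf_ne p
  have h4 : (Finset.univ.filter fun p' : (ι → ZMod 3) × ι =>
      p'.1 = 0 ∧ colOf p' = colOf p).card ≤ 1 :=
    card_filter_le_one fun a b ha hb =>
      colOf_injOn_row (ha.1.trans hb.1.symm) (ha.2.trans hb.2.symm)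
  simp only [Nat.cast_id] at h2
  omega

/-- Row and column contribute `Fintype.card ι - 1` each. One more unit arises from the row, which
meets the columns through the zero row in at most one point, whose pair must be paid in full. -/
lemma rowOrientation_sum_le {p : (ι → ZMod 3) × ι} (hp : p.1 ≠ 0)
    (hr : ¬ ∃ t, colOf p = Pi.single t 1) :
    ∑ p', rowOrientation p p' + 1 ≤ 2 * Fintype.card ι := by
  classical
  have h1 : ∀ p', rowOrientation p p' ≤ (if p' ≠ p ∧ colOf p' = colOf p then 1 else 0) +
      (if p' ≠ p ∧ p'.1 = p.1 then 1 else 0) +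
      (if p'.1 = p.1 ∧ ∃ t, colOf p' = Pi.single t 1 then 1 else 0) := by
    intro p'
    unfold rowOrientation
    by_cases h0 : p' = p
    · simp [h0]
    by_cases hc : colOf p' = colOf p
    · have h3 : p'.1 ≠ 0 := fun h => hr ⟨p'.2, by rw [← hc, colOf_of_fst_eq_zero h]⟩
      simp [h0, hc, h3]
      omega
    · by_cases hf : p'.1 = p.1
      · simp only [h0, hc, hf, hr, if_false, if_true, ne_eq, not_false_eq_true, true_and,
          and_false]
        split_ifs <;> simp
      · simp [h0, hc, hf]
  have h2 := Finset.sum_le_sum fun p' (_ : p' ∈ Finset.univ) => h1 p'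
  rw [Finset.sum_add_distrib, Finset.sum_add_distrib, Finset.sum_boole, Finset.sum_boole,
    Finset.sum_boole] at h2
  have h3 := card_line_colOf_ne p
  have h5 := card_line_fst_ne p
  have h4 : (Finset.univ.filter fun p' : (ι → ZMod 3) × ι =>
      p'.1 = p.1 ∧ ∃ t, colOf p' = Pi.single t 1).card ≤ 1 :=
    card_filter_le_one fun a b ha hb => by
      obtain ⟨ha, t, ht⟩ := ha
      obtain ⟨hb, t', ht'⟩ := hb
      exact eq_of_colOf_eq_single (ha ▸ hp) (ha.trans hb.symm) ht ht'
  simp only [Nat.cast_id] at h2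
  omega

lemma rowOrientation_add {p p' : (ι → ZMod 3) × ι} (hp : p.1 ≠ 0) (hpp : p ≠ p')
    (h : p.1 = p'.1 ∨ colOf p = colOf p') :
    2 ≤ rowOrientation p p' + rowOrientation p' p := by
  classical
  unfold rowOrientation
  rw [if_neg hpp, if_neg hpp.symm]
  by_cases hc : colOf p = colOf p'
  · rw [if_pos hc, if_pos hc.symm]
    split_ifs <;> omega
  · have hf : p.1 = p'.1 := h.resolve_right hc
    rw [if_neg hc, if_neg (Ne.symm hc), if_pos hf, if_pos hf.symm]
    split_ifs with h1 h2 h2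
    · obtain ⟨t, ht⟩ := h1
      obtain ⟨t', ht'⟩ := h2
      exact absurd (eq_of_colOf_eq_single hp hf ht ht') hpp
    all_goals omega

lemma rowOrientation_root {p p' : (ι → ZMod 3) × ι} (hp : p.1 ≠ 0) (hp' : p'.1 = 0)
    (h : p.1 = p'.1 ∨ colOf p = colOf p') : 2 ≤ rowOrientation p p' := by
  have hc : colOf p = colOf p' := h.resolve_left fun h => hp (h.trans hp')
  have hne : p' ≠ p := by
    rintro rfl
    exact hp hp'
  rw [rowOrientation, if_neg hne, if_pos hc.symm, if_pos hp']

end Orientation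

/-! ### Ports of fans -/

section Fan

variable {ι : Type} [Fintype ι] [DecidableEq ι] {φ : (ι → ZMod 3) × ι → ℕ}
  {idx : (ι → ZMod 3) × ι → ι → ZMod 3} {x x' : ℕ}

/-- If only the line `a₀` of a fan has two vertices in `N`, then only this line contributes to the
ports. -/
lemma port_fan_eq {N : Finset ℕ} (a₀ : ι → ZMod 3)
    (h : ∀ a, 2 ≤ (insert x (block φ idx a) ∩ N).card → a = a₀) (w : ℕ) :
    port N (fan φ idx x) w = port N {insert x (block φ idx a₀)} w := by
  rw [port_fan, port_singleton]
  split_ifs with hw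
  · rw [Finset.card_eq_one]
    refine ⟨a₀, ?_⟩
    ext a
    simp only [Finset.mem_filter_univ, Finset.mem_singleton]
    exact ⟨fun ha => h a ha.2.2, fun ha => ha ▸ hw⟩
  · rw [Finset.card_eq_zero, Finset.filter_eq_empty_iff]
    rintro a - ha
    exact hw (h a ha.2.2 ▸ ha)

lemma port_fan_eq_zero {N : Finset ℕ}
    (h : ∀ a, (insert x (block φ idx a) ∩ N).card ≤ 1) (w : ℕ) :
    port N (fan φ idx x) w = 0 := by
  rw [port_fan, Finset.card_eq_zero, Finset.filter_eq_empty_iff]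
  rintro a - ⟨-, -, ha⟩
  have := h a
  omega

lemma card_insert_inter_le (N : Finset ℕ) (a : ι → ZMod 3)
    (h : ∀ p, idx p = a → φ p ∉ N) : (insert x (block φ idx a) ∩ N).card ≤ 1 := by
  refine Finset.card_le_one.2 ?_
  have : ∀ u ∈ insert x (block φ idx a) ∩ N, u = x := by
    intro u hu
    rw [Finset.mem_inter, Finset.mem_insert] at hu
    rcases hu.1 with rfl | hb
    · rfl
    · obtain ⟨p, hp, rfl⟩ := exists_of_mem_block hb
      exact absurd hu.2 (h p hp)
  intro u hu v hv
  rw [this u hu, this v hv]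

lemma card_insert_inter_le' (N : Finset ℕ) (hx : x ∉ N) (a : ι → ZMod 3)
    (h : ∀ p p', idx p = a → idx p' = a → φ p ∈ N → φ p' ∈ N → p = p') :
    (insert x (block φ idx a) ∩ N).card ≤ 1 := by
  rw [Finset.insert_inter_of_notMem hx]
  refine Finset.card_le_one.2 fun u hu v hv => ?_
  rw [Finset.mem_inter] at hu hv
  obtain ⟨p, hp, rfl⟩ := exists_of_mem_block hu.1
  obtain ⟨p', hp', rfl⟩ := exists_of_mem_block hv.1
  rw [h p p' hp hp' hu.2 hv.2]

lemma port_fan_le_one {N : Finset ℕ} (hφ : φ.Injective) (p : (ι → ZMod 3) × ι) (hx : φ p ≠ x) :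
    port N (fan φ idx x) (φ p) ≤ 1 := by
  rw [port_fan]
  refine card_filter_le_one fun a b ha hb => ?_
  have h1 := ha.1
  have h2 := hb.1
  rw [Finset.mem_insert, mem_block hφ] at h1 h2
  rw [← h1.resolve_left hx, ← h2.resolve_left hx]

/-- A fan without the line with index `a₀`. -/
def fanRest (φ : (ι → ZMod 3) × ι → ℕ) (idx : (ι → ZMod 3) × ι → ι → ZMod 3) (x : ℕ)
    (a₀ : ι → ZMod 3) : Multiset (Finset ℕ) :=
  (Finset.univ.erase a₀).val.map fun a => insert x (block φ idx a)

lemma fan_eq_cons (a₀ : ι → ZMod 3) :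
    fan φ idx x = insert x (block φ idx a₀) ::ₘ fanRest φ idx x a₀ := by
  rw [fan, ← Finset.insert_erase (Finset.mem_univ a₀),
    Finset.insert_val_of_notMem (Finset.notMem_erase _ _), Multiset.map_cons]
  rfl

lemma mem_fanRest {a₀ : ι → ZMod 3} {K : Finset ℕ} :
    K ∈ fanRest φ idx x a₀ ↔ ∃ a, a ≠ a₀ ∧ insert x (block φ idx a) = K := by
  simp only [fanRest, Multiset.mem_map, Finset.mem_val, Finset.mem_erase, Finset.mem_univ, and_true]

end Fan

lemma exists_enumeration {n : ℕ} {F : Finset ℕ} (h : F.card = n) :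
    ∃ c : Fin n → ℕ, c.Injective ∧ (∀ s, c s ∈ F) ∧ ∀ u ∈ F, ∃ s, c s = u := by
  let e := F.equivFinOfCardEq h
  exact ⟨fun s => e.symm s, fun s t hst => e.symm.injective (Subtype.ext hst),
    fun s => (e.symm s).2, fun u hu => ⟨e ⟨u, hu⟩, by simp⟩⟩

/-! ### Reducing a clique to two vertices in N -/

/-- A member of `D₂` with at least three vertices in `N` can be replaced by one with one vertex
fewer in `N`. -/
theorem IsBalancedPair.reduce {q : ℕ} (hq : 4 ≤ q) {N X K : Finset ℕ}
    {D₁ E : Multiset (Finset ℕ)} (h : IsBalancedPair q N X D₁ (K ::ₘ E))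
    (hnarrow : ∀ J ∈ D₁ + E, (J ∩ N).card ≤ 2) (hK : 3 ≤ (K ∩ N).card) :
    ∃ X' K' D₁' E', IsBalancedPair q N X' D₁' (K' ::ₘ E') ∧
      (∀ J ∈ D₁' + E', (J ∩ N).card ≤ 2) ∧ (K' ∩ N).card + 1 = (K ∩ N).card ∧
      ∀ u v, u ≠ v → cov D₁ u v + cov (K' ::ₘ E') u v = cov D₁' u v + cov (K ::ₘ E) u v := by
  classical
  obtain ⟨x, hxKN⟩ := Finset.card_pos.1 (show 0 < (K ∩ N).card by omega)
  obtain ⟨hxK, hxN⟩ := Finset.mem_inter.1 hxKN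
  have hKX : K ⊆ X := h.sub₂ K (Multiset.mem_cons_self _ _)
  have hKq : K.card = q := h.card_eq K (Multiset.mem_add.2 (Or.inr (Multiset.mem_cons_self _ _)))
  have hxX := h.base hxN
  have hKx : (K.erase x).card = q - 1 := by rw [Finset.card_erase_of_mem hxK, hKq]
  obtain ⟨c, hc, hcK, hKc⟩ := exists_enumeration hKx
  have hι : Fintype.card (Fin (q - 1)) + 1 = q := by
    rw [Fintype.card_fin]
    omega
  obtain ⟨ψ, hψ, hψX⟩ := exists_fresh X (Option ((Fin (q - 1) → ZMod 3) × Fin (q - 1)))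
  set x' := ψ none with hx'def
  -- The zero row is K without x; every other point is fresh.
  let φ : (Fin (q - 1) → ZMod 3) × Fin (q - 1) → ℕ := fun p =>
    if p.1 = 0 then c p.2 else ψ (some p)
  have hφ0 : ∀ p, p.1 = 0 → φ p = c p.2 := fun p hp => if_pos hp
  have hφ1 : ∀ p, p.1 ≠ 0 → φ p = ψ (some p) := fun p hp => if_neg hp
  have hmemK : ∀ s, c s ∈ K := fun s => Finset.mem_of_mem_erase (hcK s)
  have hφX : ∀ p, φ p ∈ X ↔ p.1 = 0 := by
    intro p
    by_cases hp : p.1 = 0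
    · simp only [hφ0 p hp, hp, iff_true]
      exact hKX (hmemK _)
    · simp only [hφ1 p hp, hp, iff_false]
      exact hψX _
  have hφ : φ.Injective := by
    intro p p' hpp
    by_cases hp : p.1 = 0
    · have hp' : p'.1 = 0 := (hφX p').1 (hpp ▸ (hφX p).2 hp)
      rw [hφ0 p hp, hφ0 p' hp'] at hpp
      exact Prod.ext (hp.trans hp'.symm) (hc hpp)
    · have hp' : p'.1 ≠ 0 := fun hh => hp ((hφX p).1 (hpp ▸ (hφX p').2 hh))
      rw [hφ1 p hp, hφ1 p' hp'] at hpp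
      exact Option.some_injective _ (hψ hpp)
  have hx'X : x' ∉ X := hψX none
  have hx'N : x' ∉ N := fun hh => hx'X (h.base hh)
  have hx : ∀ p, φ p ≠ x := by
    intro p hp
    have h0 : p.1 = 0 := (hφX p).1 (hp ▸ hxX)
    rw [hφ0 p h0] at hp
    exact Finset.ne_of_mem_erase (hcK p.2) hp
  have hx' : ∀ p, φ p ≠ x' := by
    intro p hp
    have h0 : p.1 ≠ 0 := fun hh => hx'X (hp ▸ (hφX p).2 hh)
    rw [hφ1 p h0] at hp
    exact Option.some_ne_none _ (hψ hp)
  have hφN : ∀ p, φ p ∈ N → p.1 = 0 := fun p hp => (hφX p).1 (h.base hp)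
  have hrow : block φ Prod.fst 0 = K.erase x := by
    ext u
    constructor
    · intro hu
      obtain ⟨p, hp, rfl⟩ := exists_of_mem_block hu
      rw [hφ0 p hp]
      exact hcK p.2
    · intro hu
      obtain ⟨s, rfl⟩ := hKc u hu
      have : φ (0, s) = c s := hφ0 _ rfl
      rw [← this, mem_block hφ]
  have hKrow : insert x (block φ Prod.fst 0) = K := by rw [hrow, Finset.insert_erase hxK]
  set K' := insert x' (block φ Prod.fst 0) with hK'def
  have hK'N : K' ∩ N = (K ∩ N).erase x := by
    rw [hK'def, Finset.insert_inter_of_notMem hx'N, hrow, Finset.erase_inter]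
  have hK'card : (K' ∩ N).card + 1 = (K ∩ N).card := by
    rw [hK'N, Finset.card_erase_add_one hxKN]
  have hrow_ne : ∀ a, a ≠ 0 → ∀ h, (insert h (block φ Prod.fst a) ∩ N).card ≤ 1 :=
    fun a ha h => card_insert_inter_le N a fun p hp hpN => ha (hp ▸ hφN p hpN)
  have hcol' : ∀ a, (insert x' (block φ colOf a) ∩ N).card ≤ 1 := fun a =>
    card_insert_inter_le' N hx'N a fun p p' hp hp' hpN hpN' =>
      colOf_injOn_row ((hφN p hpN).trans (hφN p' hpN').symm) (hp.trans hp'.symm)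
  have hcol : ∀ a, (insert x (block φ colOf a) ∩ N).card ≤ 2 := fun a => by
    have h1 : insert x (block φ colOf a) ∩ N ⊆ insert x (insert x' (block φ colOf a) ∩ N) := by
      intro u
      simp only [Finset.mem_inter, Finset.mem_insert]
      tauto
    have h2 := (Finset.card_le_card h1).trans (Finset.card_insert_le _ _)
    have h3 := hcol' a
    omega
  set D₁' := D₁ + (fanRest φ Prod.fst x 0 + fan φ colOf x') with hD₁'
  set E' := E + (fanRest φ Prod.fst x' 0 + fan φ colOf x) with hE'
  -- K is the zero row of the trade added to the D₁ side and an old member of the D₂ side, so it can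
  -- be deleted from both.
  have hZ₁ : D₁' + {K} = D₁ + trade φ x x' := by
    rw [trade, fan_eq_cons (idx := Prod.fst) 0, hKrow, hD₁', ← Multiset.singleton_add]
    abel
  have hZ₂ : (K' ::ₘ E') + {K} = (K ::ₘ E) + trade φ x' x := by
    rw [trade, fan_eq_cons (idx := Prod.fst) 0, ← hK'def, hE', ← Multiset.singleton_add,
      ← Multiset.singleton_add, ← Multiset.singleton_add]
    abel
  have pa : ∀ w, port N (fan φ Prod.fst x) w = port N {K} w := fun w => by
    rw [port_fan_eq 0 _ w, hKrow]
    intro a ha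
    by_contra ha0
    have := hrow_ne a ha0 x
    omega
  have pb : ∀ w, port N (fan φ colOf x') w = 0 := port_fan_eq_zero hcol'
  have pc : ∀ w, port N (fan φ Prod.fst x') w = port N {K'} w := fun w => by
    rw [port_fan_eq 0 _ w]
    intro a ha
    by_contra ha0
    have := hrow_ne a ha0 x'
    omega
  have pd : ∀ w, port N (fan φ colOf x) w ≠ 0 →
      ∃ p, φ p = w ∧ p.1 ≠ 0 ∧ ∃ t, colOf p = Pi.single t 1 := by
    intro w hw
    rw [port_fan, Finset.card_ne_zero] at hw
    obtain ⟨a, ha⟩ := hw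
    obtain ⟨h1, h2, h3⟩ := (Finset.mem_filter.1 ha).2
    obtain ⟨p, hp, rfl⟩ := exists_of_mem_block
      ((Finset.mem_insert.1 h1).resolve_left fun hh => h2 (hh ▸ hxN))
    have h4 : ∃ p', colOf p' = a ∧ φ p' ∈ N := by
      by_contra h4
      push Not at h4
      have := card_insert_inter_le (x := x) N a h4
      omega
    obtain ⟨p', hp', hp'N⟩ := h4
    have h5 := hφN p' hp'N
    refine ⟨p, rfl, fun hp0 => ?_, p'.2, by rw [hp, ← hp', colOf_of_fst_eq_zero h5]⟩
    rw [colOf_injOn_row (hp0.trans h5.symm) (hp.trans hp'.symm)] at h2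
    exact h2 hp'N
  have hport : ∀ w, port N (D₁' + K' ::ₘ E') w + port N {K} w =
      port N (D₁ + K ::ₘ E) w + port N {K'} w + port N (fan φ colOf x) w := by
    intro w
    have h1 := congrArg (port N · w) hZ₁
    have h2 := congrArg (port N · w) hZ₂
    simp only [trade, port_add, pa, pb, pc] at h1 h2 ⊢
    omega
  have hmK : ∀ u, u ∈ K ↔ u = x ∨ ∃ p, p.1 = 0 ∧ φ p = u := by
    intro u
    rw [← hKrow, Finset.mem_insert]
    refine or_congr_right ⟨exists_of_mem_block, ?_⟩
    rintro ⟨p, hp, rfl⟩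
    exact (mem_block hφ).2 hp
  refine ⟨insert x' (X ∪ Finset.univ.image φ \ X), K', D₁', E', ?_, ?_, hK'card, ?_⟩
  -- The q - 1 old neighbours of x' are the vertices of K other than x. All are free, so no port is
  -- spent.
  · refine h.exchange hq hι hφ hx hx' hxX hx'X hZ₁ hZ₂ (by simpa using hKX) ?_ rowOrientation ?_ ?_
      ?_ (fun u => if u ∈ K.erase x then 1 else 0) (fun _ => 0) ?_ ?_ ?_ ?_ (Or.inl fun _ _ => rfl)
    · intro u hu v hv huv _
      rw [cov_singleton]
      rcases trade_cases φ x x' u with rfl | rfl | ⟨p, rfl⟩ | ⟨h1, h2, h3⟩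
      · rcases trade_cases φ u x' v with rfl | rfl | ⟨p, rfl⟩ | ⟨h1, h2, h3⟩
        · exact absurd rfl huv
        · exact absurd hv hx'X
        · rw [cov_trade_hub hφ hx (ne_of_mem_of_not_mem hxX hx'X),
            if_pos ⟨hxK, (hmK _).2 (Or.inr ⟨p, (hφX p).1 hv, rfl⟩)⟩]
        · rw [cov_comm, cov_trade_other h1 h2 h3, if_neg]
          rintro ⟨-, hvK⟩
          rcases (hmK v).1 hvK with hh | ⟨p, -, hp⟩
          · exact h1 hh
          · exact h3 p hp
      · exact absurd hu hx'X
      · have hp0 := (hφX p).1 hu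
        have hpK : φ p ∈ K := (hmK _).2 (Or.inr ⟨p, hp0, rfl⟩)
        rcases trade_cases φ x x' v with rfl | rfl | ⟨p', rfl⟩ | ⟨h1, h2, h3⟩
        · rw [cov_comm, cov_trade_hub hφ hx (ne_of_mem_of_not_mem hxX hx'X), if_pos ⟨hpK, hxK⟩]
        · exact absurd hv hx'X
        · have hp0' := (hφX p').1 hv
          rw [cov_trade_pt hφ hx hx', if_pos (hp0.trans hp0'.symm), if_neg,
            if_pos ⟨hpK, (hmK _).2 (Or.inr ⟨p', hp0', rfl⟩)⟩]
          intro hh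
          exact huv (congrArg φ (colOf_injOn_row (hp0.trans hp0'.symm) hh))
        · rw [cov_comm, cov_trade_other h1 h2 h3, if_neg]
          rintro ⟨-, hvK⟩
          rcases (hmK v).1 hvK with hh | ⟨p, -, hp⟩
          · exact h1 hh
          · exact h3 p hp
      · rw [cov_trade_other h1 h2 h3, if_neg]
        rintro ⟨huK, -⟩
        rcases (hmK u).1 huK with hh | ⟨p, -, hp⟩
        · exact h1 hh
        · exact h3 p hp
    · intro p p' hp hp' hpp hh
      exact rowOrientation_add (fun h0 => hp ((hφX p).2 h0)) hpp hh
    · intro p p' hp hp' hh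
      exact rowOrientation_root (fun h0 => hp ((hφX p).2 h0)) ((hφX p').1 hp') hh
    · intro p hp
      have hp0 : p.1 ≠ 0 := fun h0 => hp ((hφX p).2 h0)
      have h1 := hport (φ p)
      have h2 : port N (D₁ + K ::ₘ E) (φ p) = 0 := port_eq_zero h.sub hp
      have h3 : port N {K'} (φ p) = 0 := by
        rw [port_singleton, if_neg]
        rintro ⟨hh, -⟩
        rcases Finset.mem_insert.1 hh with hh | hh
        · exact hx' p hh
        · exact hp0 ((mem_block hφ).1 hh)
      -- Only points on columns through the zero row can become ports. They own weight at most q -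
      -- 1, and q - 1 + 2 + 3 ≤ 2q uses q ≥ 4.
      by_cases hr : ∃ t, colOf p = Pi.single t 1
      · have h4 := rowOrientation_sum_rooted hr
        have h5 := port_fan_le_one (N := N) (idx := colOf) hφ p (hx p)
        omega
      · have h4 := rowOrientation_sum_le hp0 hr
        have h5 : port N (fan φ colOf x) (φ p) = 0 := by
          by_contra h5
          obtain ⟨p', hp', -, ht⟩ := pd _ h5
          exact hr (hφ hp' ▸ ht)
        omega
    · intro u hu
      have h1 := hport u
      have h2 : port N (fan φ colOf x) u = 0 := by
        by_contra h5
        obtain ⟨p, rfl, hp0, -⟩ := pd _ h5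
        exact hp0 ((hφX p).1 hu)
      -- An old vertex of K' lies in K, which already has at least three vertices in N; hence no
      -- port arises on X.
      have h3 : port N {K'} u ≤ port N {K} u := by
        rw [port_singleton, port_singleton]
        split_ifs with h4 h5
        · exact le_rfl
        · refine absurd ⟨?_, h4.2.1, by omega⟩ h5
          rcases Finset.mem_insert.1 h4.1 with hh | hh
          · exact absurd hu (hh ▸ hx'X)
          · exact Finset.mem_of_mem_erase (hrow ▸ hh)
        · simp
        · simp
      omega
    · intro u hu
      have h1 := hport u
      have h2 : port N (D₁ + K ::ₘ E) u = 0 := port_eq_zero h.sub hu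
      by_cases h5 : port N (fan φ colOf x) u = 0
      · have h3 : port N {K'} u ≤ 1 := by
          rw [port_singleton]
          split_ifs <;> simp
        omega
      · obtain ⟨p, rfl, hp0, -⟩ := pd _ h5
        have h3 : port N {K'} (φ p) = 0 := by
          rw [port_singleton, if_neg]
          rintro ⟨hh, -⟩
          rcases Finset.mem_insert.1 hh with hh | hh
          · exact hx' p hh
          · exact hp0 ((mem_block hφ).1 hh)
        have h5 := port_fan_le_one (N := N) (idx := colOf) hφ p (hx p)
        omega
    · intro p hp
      rw [if_pos]
      rw [← hrow, mem_block hφ]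
      exact (hφX p).1 hp
    · rw [Finset.sum_ite_mem, Finset.inter_eq_right.2 ((Finset.erase_subset _ _).trans hKX)]
      simp only [Finset.sum_const, smul_eq_mul, mul_one]
      omega
  · intro J hJ
    simp only [hD₁', hE', Multiset.mem_add, mem_fanRest, mem_fan] at hJ
    rcases hJ with (hJ | ⟨a, ha, rfl⟩ | ⟨a, rfl⟩) | (hJ | ⟨a, ha, rfl⟩ | ⟨a, rfl⟩)
    · exact hnarrow J (Multiset.mem_add.2 (Or.inl hJ))
    · exact (hrow_ne a ha x).trans one_le_two
    · exact (hcol' a).trans one_le_two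
    · exact hnarrow J (Multiset.mem_add.2 (Or.inr hJ))
    · exact (hrow_ne a ha x').trans one_le_two
    · exact hcol a
  · intro u v huv
    have h1 := congrArg (cov · u v) hZ₁
    have h2 := congrArg (cov · u v) hZ₂
    have h3 := cov_trade_swap hφ hx hx' (fun hh => hx'N (hh ▸ hxN)) huv
    simp only [cov_add] at h1 h2
    omega

/-! ### Closing a pair covered on both sides -/

/-- The number of members of `D` with at least two vertices in `N`. -/
def wideCount (N : Finset ℕ) (D : Multiset (Finset ℕ)) : ℕ := D.countP fun J => 2 ≤ (J ∩ N).card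

section CrossOrientation

variable {ι : Type} [Fintype ι] [DecidableEq ι]

/-- The orientation used when the zero row and one further column are old. -/
def crossOrientation (b₀ : ι → ZMod 3) (p p' : (ι → ZMod 3) × ι) : ℕ :=
  if p' ≠ p ∧ (p'.1 = p.1 ∨ colOf p' = colOf p) then
    (if p'.1 = 0 ∨ colOf p' = b₀ then 2 else 1) else 0

/-- At most one pair needs a surcharge. Old neighbours both in the row and in the column would make
the row of p meet two distinct columns through the zero row. -/
lemma crossOrientation_sum_le {s₀ : ι} {p : (ι → ZMod 3) × ι} (hp : p.1 ≠ 0)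
    (hpb : colOf p ≠ Pi.single s₀ 1) :
    ∑ p', crossOrientation (Pi.single s₀ 1) p p' + 1 ≤ 2 * Fintype.card ι := by
  have h1 : ∀ p', crossOrientation (Pi.single s₀ 1) p p' ≤
      (if p' ≠ p ∧ colOf p' = colOf p then 1 else 0) +
      (if p' ≠ p ∧ p'.1 = p.1 then 1 else 0) +
      (if (p'.1 = 0 ∧ colOf p' = colOf p) ∨ (colOf p' = Pi.single s₀ 1 ∧ p'.1 = p.1)
        then 1 else 0) := by
    intro p'
    unfold crossOrientation
    by_cases h0 : p' = p
    · simp [h0]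
    by_cases hf : p'.1 = p.1
    · by_cases hc : colOf p' = colOf p
      · exact absurd (colOf_injOn_row hf hc) h0
      · simp only [h0, hc, hf, hp, ne_eq, not_false_eq_true, and_false,
          true_or, if_true, if_false, false_or, and_true]
        split_ifs <;> simp
    · by_cases hc : colOf p' = colOf p
      · simp only [h0, hc, hf, hpb, ne_eq, not_false_eq_true, and_false,
          or_true, if_true, if_false, or_false, and_true]
        split_ifs <;> simp
      · simp [hc, hf]
  have h2 := Finset.sum_le_sum fun p' (_ : p' ∈ Finset.univ) => h1 p'
  rw [Finset.sum_add_distrib, Finset.sum_add_distrib, Finset.sum_boole, Finset.sum_boole,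
    Finset.sum_boole] at h2
  have h3 := card_line_colOf_ne p
  have h5 := card_line_fst_ne p
  have hmix : ∀ a b : (ι → ZMod 3) × ι, (a.1 = 0 ∧ colOf a = colOf p) →
      (colOf b = Pi.single s₀ 1 ∧ b.1 = p.1) → False := by
    rintro a b ⟨ha0, ha⟩ ⟨hb0, hb⟩
    have h := eq_of_colOf_eq_single hp hb.symm (ha.symm.trans (colOf_of_fst_eq_zero ha0)) hb0
    exact hpb (h ▸ hb0)
  have h4 : (Finset.univ.filter fun p' : (ι → ZMod 3) × ι =>
      (p'.1 = 0 ∧ colOf p' = colOf p) ∨ (colOf p' = Pi.single s₀ 1 ∧ p'.1 = p.1)).card ≤ 1 :=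
    card_filter_le_one fun a b ha hb => by
      rcases ha with ha | ha <;> rcases hb with hb | hb
      · exact colOf_injOn_row (ha.1.trans hb.1.symm) (ha.2.trans hb.2.symm)
      · exact (hmix a b ha hb).elim
      · exact (hmix b a hb ha).elim
      · exact colOf_injOn_row (ha.2.trans hb.2.symm) (ha.1.trans hb.1.symm)
  simp only [Nat.cast_id] at h2
  omega

lemma crossOrientation_pos {b₀ : ι → ZMod 3} {p p' : (ι → ZMod 3) × ι} (hpp : p ≠ p')
    (h : p.1 = p'.1 ∨ colOf p = colOf p') : 1 ≤ crossOrientation b₀ p p' := by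
  rw [crossOrientation, if_pos ⟨hpp.symm, h.imp Eq.symm Eq.symm⟩]
  split_ifs <;> omega

lemma crossOrientation_root {b₀ : ι → ZMod 3} {p p' : (ι → ZMod 3) × ι} (hpp : p ≠ p')
    (h : p.1 = p'.1 ∨ colOf p = colOf p') (hp' : p'.1 = 0 ∨ colOf p' = b₀) :
    2 ≤ crossOrientation b₀ p p' := by
  rw [crossOrientation, if_pos ⟨hpp.symm, h.imp Eq.symm Eq.symm⟩, if_pos hp']

end CrossOrientation

/-- A member of `D₁` and a member of `D₂` that share a pair inside `N` can both be eliminated. -/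
theorem IsBalancedPair.close {q : ℕ} (hq : 4 ≤ q) {N X K K₂ : Finset ℕ}
    {E₁ E₂ : Multiset (Finset ℕ)} (h : IsBalancedPair q N X (K₂ ::ₘ E₁) (K ::ₘ E₂))
    (hnarrow : ∀ J ∈ (K₂ ::ₘ E₁) + (K ::ₘ E₂), (J ∩ N).card ≤ 2) {x m : ℕ} (hxm : x ≠ m)
    (hxN : x ∈ N) (hmN : m ∈ N) (hxK : x ∈ K) (hmK : m ∈ K) (hxK₂ : x ∈ K₂) (hmK₂ : m ∈ K₂) :
    ∃ X' D₁' D₂', IsBalancedPair q N X' D₁' D₂' ∧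
      (∀ J ∈ D₁' + D₂', (J ∩ N).card ≤ 2) ∧
      wideCount N (D₁' + D₂') < wideCount N ((K₂ ::ₘ E₁) + (K ::ₘ E₂)) ∧
      ∀ u v, u ≠ v → cov (K₂ ::ₘ E₁) u v + cov D₂' u v = cov D₁' u v + cov (K ::ₘ E₂) u v := by
  classical
  have hKmem : K ∈ (K₂ ::ₘ E₁) + (K ::ₘ E₂) := by simp
  have hK₂mem : K₂ ∈ (K₂ ::ₘ E₁) + (K ::ₘ E₂) := by simp
  have hKX : K ⊆ X := h.sub K hKmem
  have hK₂X : K₂ ⊆ X := h.sub K₂ hK₂mem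
  have hKq : K.card = q := h.card_eq K hKmem
  have hK₂q : K₂.card = q := h.card_eq K₂ hK₂mem
  have hxX := h.base hxN
  have hpair : ∀ J ∈ (K₂ ::ₘ E₁) + (K ::ₘ E₂), x ∈ J → m ∈ J →
      2 ≤ (J ∩ N).card ∧ ∀ w ∈ J, w ∈ N → w ≠ x → w = m := by
    intro J hJ hxJ hmJ
    have h1 : ({x, m} : Finset ℕ) ⊆ J ∩ N := by
      intro u hu
      rcases Finset.mem_insert.1 hu with rfl | hu
      · exact Finset.mem_inter.2 ⟨hxJ, hxN⟩
      · rw [Finset.mem_singleton.1 hu]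
        exact Finset.mem_inter.2 ⟨hmJ, hmN⟩
    have h2 := Finset.card_pair hxm
    refine ⟨h2 ▸ Finset.card_le_card h1, fun w hw hwN hwx => ?_⟩
    have h3 := Finset.eq_of_subset_of_card_le h1 (h2 ▸ hnarrow J hJ)
    have h4 : w ∈ ({x, m} : Finset ℕ) := h3 ▸ Finset.mem_inter.2 ⟨hw, hwN⟩
    simpa [hwx] using h4
  obtain ⟨hK2, hKm⟩ := hpair K hKmem hxK hmK
  obtain ⟨hK₂2, hK₂m⟩ := hpair K₂ hK₂mem hxK₂ hmK₂
  -- A common vertex outside N would lie in two cliques with two vertices in N, against the port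
  -- bound. So the zero row and the column b₀ can be embedded disjointly apart from m.
  have hKK₂ : ∀ w ∈ K, w ∈ K₂ → w ∈ N := by
    intro w hw hw₂
    by_contra hwN
    have h1 := h.port_le w
    rw [← Multiset.singleton_add, ← Multiset.singleton_add] at h1
    have h2 : w ∈ K ∧ w ∉ N ∧ 2 ≤ (K ∩ N).card := ⟨hw, hwN, hK2⟩
    have h3 : w ∈ K₂ ∧ w ∉ N ∧ 2 ≤ (K₂ ∩ N).card := ⟨hw₂, hwN, hK₂2⟩
    simp only [port_add, port_singleton, if_pos h2, if_pos h3] at h1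
    omega
  have hKx : (K.erase x).card = q - 1 := by rw [Finset.card_erase_of_mem hxK, hKq]
  have hK₂x : (K₂.erase x).card = q - 1 := by rw [Finset.card_erase_of_mem hxK₂, hK₂q]
  obtain ⟨c, hc, hcK, hKc⟩ := exists_enumeration hKx
  obtain ⟨s₀, hs₀⟩ := hKc m (Finset.mem_erase.2 ⟨hxm.symm, hmK⟩)
  -- The enumeration of K₂ is permuted so that m has the index s₀ it has in K, because the zero row
  -- and the column b₀ cross at (0, s₀).
  obtain ⟨d, hd, hdK, hKd, hds₀⟩ : ∃ d : Fin (q - 1) → ℕ, d.Injective ∧ (∀ s, d s ∈ K₂.erase x) ∧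
      (∀ u ∈ K₂.erase x, ∃ s, d s = u) ∧ d s₀ = m := by
    obtain ⟨d, hd, hdK, hKd⟩ := exists_enumeration hK₂x
    obtain ⟨t₀, ht₀⟩ := hKd m (Finset.mem_erase.2 ⟨hxm.symm, hmK₂⟩)
    refine ⟨d ∘ Equiv.swap s₀ t₀, hd.comp (Equiv.injective _), fun s => hdK _, fun u hu => ?_,
      by simpa using ht₀⟩
    obtain ⟨s, rfl⟩ := hKd u hu
    exact ⟨Equiv.swap s₀ t₀ s, by simp⟩
  have hι : Fintype.card (Fin (q - 1)) + 1 = q := by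
    rw [Fintype.card_fin]
    omega
  obtain ⟨ψ, hψ, hψX⟩ := exists_fresh X (Option ((Fin (q - 1) → ZMod 3) × Fin (q - 1)))
  set x' := ψ none with hx'def
  set b₀ : Fin (q - 1) → ZMod 3 := Pi.single s₀ 1 with hb₀
  let φ : (Fin (q - 1) → ZMod 3) × Fin (q - 1) → ℕ := fun p =>
    if p.1 = 0 then c p.2 else if colOf p = b₀ then d p.2 else ψ (some p)
  have hφ0 : ∀ p, p.1 = 0 → φ p = c p.2 := fun p hp => if_pos hp
  have hφ1 : ∀ p, colOf p = b₀ → φ p = d p.2 := fun p hp => by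
    by_cases hp0 : p.1 = 0
    · have h1 : p.2 = s₀ := single_one_injective ((colOf_of_fst_eq_zero hp0).symm.trans hp)
      rw [hφ0 p hp0, h1, hs₀, hds₀]
    · exact (if_neg hp0).trans (if_pos hp)
  have hφ2 : ∀ p, p.1 ≠ 0 → colOf p ≠ b₀ → φ p = ψ (some p) := fun p hp hp' =>
    (if_neg hp).trans (if_neg hp')
  have hφX : ∀ p, φ p ∈ X ↔ p.1 = 0 ∨ colOf p = b₀ := by
    intro p
    by_cases hp : p.1 = 0
    · simp only [hφ0 p hp, hp, true_or, iff_true]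
      exact hKX (Finset.mem_of_mem_erase (hcK _))
    by_cases hp' : colOf p = b₀
    · simp only [hφ1 p hp', hp', or_true, iff_true]
      exact hK₂X (Finset.mem_of_mem_erase (hdK _))
    · simp only [hφ2 p hp hp', hp, hp', or_self, iff_false]
      exact hψX _
  have hφN : ∀ p, φ p ∈ N → p.1 = 0 ∧ p.2 = s₀ := by
    intro p hp
    by_cases hp0 : p.1 = 0
    · refine ⟨hp0, hc ?_⟩
      rw [hφ0 p hp0] at hp
      rw [hs₀]
      exact hKm _ (Finset.mem_of_mem_erase (hcK _)) hp (Finset.ne_of_mem_erase (hcK _))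
    · have hp1 := ((hφX p).1 (h.base hp)).resolve_left hp0
      rw [hφ1 p hp1] at hp
      have h1 : p.2 = s₀ := hd <| by
        rw [hds₀]
        exact hK₂m _ (Finset.mem_of_mem_erase (hdK _)) hp (Finset.ne_of_mem_erase (hdK _))
      rw [colOf, h1, hb₀] at hp1
      exact absurd (add_eq_right.1 hp1) hp0
  have hcross : ∀ p p', p.1 = 0 → colOf p' = b₀ → φ p = φ p' → p = p' := by
    intro p p' hp hp' hpp
    have h1 : φ p ∈ K := hφ0 p hp ▸ Finset.mem_of_mem_erase (hcK _)
    have h2 : φ p' ∈ K₂ := hφ1 p' hp' ▸ Finset.mem_of_mem_erase (hdK _)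
    have h3 : φ p ∈ N := hKK₂ _ h1 (hpp ▸ h2)
    obtain ⟨h4, h5⟩ := hφN p h3
    obtain ⟨h6, h7⟩ := hφN p' (hpp ▸ h3)
    exact Prod.ext (h4.trans h6.symm) (h5.trans h7.symm)
  have hφ : φ.Injective := by
    intro p p' hpp
    by_cases hpX : φ p ∈ X
    · have hpX' : φ p' ∈ X := hpp ▸ hpX
      rcases (hφX p).1 hpX with hp | hp <;> rcases (hφX p').1 hpX' with hp' | hp'
      · rw [hφ0 p hp, hφ0 p' hp'] at hpp
        exact Prod.ext (hp.trans hp'.symm) (hc hpp)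
      · exact hcross p p' hp hp' hpp
      · exact (hcross p' p hp' hp hpp.symm).symm
      · rw [hφ1 p hp, hφ1 p' hp'] at hpp
        have h2 : p.2 = p'.2 := hd hpp
        refine Prod.ext ?_ h2
        have h3 := hp.trans hp'.symm
        rw [colOf, colOf, h2] at h3
        exact add_right_cancel h3
    · have hpX' : φ p' ∉ X := hpp ▸ hpX
      rw [hφX, not_or] at hpX hpX'
      rw [hφ2 p hpX.1 hpX.2, hφ2 p' hpX'.1 hpX'.2] at hpp
      exact Option.some_injective _ (hψ hpp)
  have hx'X : x' ∉ X := hψX none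
  have hx'N : x' ∉ N := fun hh => hx'X (h.base hh)
  have hxx : x ≠ x' := ne_of_mem_of_not_mem hxX hx'X
  have hx : ∀ p, φ p ≠ x := by
    intro p hp
    rcases (hφX p).1 (hp ▸ hxX) with h0 | h0
    · exact Finset.ne_of_mem_erase (hcK p.2) (hφ0 p h0 ▸ hp)
    · exact Finset.ne_of_mem_erase (hdK p.2) (hφ1 p h0 ▸ hp)
  have hx' : ∀ p, φ p ≠ x' := by
    intro p hp
    have h0 := (not_congr (hφX p)).1 fun hh => hx'X (hp ▸ hh)
    rw [not_or] at h0
    rw [hφ2 p h0.1 h0.2] at hp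
    exact Option.some_ne_none _ (hψ hp)
  have hrow : insert x (block φ Prod.fst 0) = K := by
    rw [← Finset.insert_erase hxK]
    congr 1
    ext u
    constructor
    · intro hu
      obtain ⟨p, hp, rfl⟩ := exists_of_mem_block hu
      rw [hφ0 p hp]
      exact hcK p.2
    · intro hu
      obtain ⟨s, rfl⟩ := hKc u hu
      have : φ (0, s) = c s := hφ0 _ rfl
      rw [← this, mem_block hφ]
  have hcol : insert x (block φ colOf b₀) = K₂ := by
    rw [← Finset.insert_erase hxK₂]
    congr 1
    ext u
    constructor
    · intro hu
      obtain ⟨p, hp, rfl⟩ := exists_of_mem_block hu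
      rw [hφ1 p hp]
      exact hdK p.2
    · intro hu
      obtain ⟨s, rfl⟩ := hKd u hu
      have h1 : colOf (b₀ - Pi.single s 1, s) = b₀ := by simp [colOf]
      have : φ (b₀ - Pi.single s 1, s) = d s := hφ1 _ h1
      rw [← this, mem_block hφ]
      exact h1
  have hpK : ∀ p, φ p ∈ K ↔ p.1 = 0 := fun p => by
    rw [← hrow, Finset.mem_insert, or_iff_right (hx p), mem_block hφ]
  have hpK₂ : ∀ p, φ p ∈ K₂ ↔ colOf p = b₀ := fun p => by
    rw [← hcol, Finset.mem_insert, or_iff_right (hx p), mem_block hφ]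
  have huniq : ∀ p p', φ p ∈ N → φ p' ∈ N → p = p' := fun p p' hp hp' =>
    Prod.ext ((hφN p hp).1.trans (hφN p' hp').1.symm) ((hφN p hp).2.trans (hφN p' hp').2.symm)
  have hrow_ne : ∀ a, a ≠ 0 → (insert x (block φ Prod.fst a) ∩ N).card ≤ 1 :=
    fun a ha => card_insert_inter_le N a fun p hp hpN => ha (hp ▸ (hφN p hpN).1)
  have hcol_ne : ∀ b, b ≠ b₀ → (insert x (block φ colOf b) ∩ N).card ≤ 1 :=
    fun b hb => card_insert_inter_le N b fun p hp hpN => hb <| by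
      rw [← hp, colOf_of_fst_eq_zero (hφN p hpN).1, (hφN p hpN).2]
  have hrow' : ∀ a, (insert x' (block φ Prod.fst a) ∩ N).card ≤ 1 := fun a =>
    card_insert_inter_le' N hx'N a fun p p' _ _ => huniq p p'
  have hcol' : ∀ a, (insert x' (block φ colOf a) ∩ N).card ≤ 1 := fun a =>
    card_insert_inter_le' N hx'N a fun p p' _ _ => huniq p p'
  set D₁' := E₁ + (fanRest φ Prod.fst x 0 + fan φ colOf x') with hD₁'
  set D₂' := E₂ + (fan φ Prod.fst x' + fanRest φ colOf x b₀) with hD₂'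
  -- K is the zero row on one side of the trade and K₂ the column b₀ on the other, so each side
  -- loses both.
  have hZ₁ : D₁' + ({K} + {K₂}) = (K₂ ::ₘ E₁) + trade φ x x' := by
    rw [trade, fan_eq_cons (idx := Prod.fst) 0, hrow, hD₁', ← Multiset.singleton_add,
      ← Multiset.singleton_add]
    abel
  have hZ₂ : D₂' + ({K} + {K₂}) = (K ::ₘ E₂) + trade φ x' x := by
    rw [trade, fan_eq_cons (idx := colOf) b₀, hcol, hD₂', ← Multiset.singleton_add,
      ← Multiset.singleton_add]
    abel
  have pa : ∀ w, port N (fan φ Prod.fst x) w = port N {K} w := fun w => by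
    rw [port_fan_eq 0 _ w, hrow]
    intro a ha
    by_contra ha0
    have := hrow_ne a ha0
    omega
  have pd : ∀ w, port N (fan φ colOf x) w = port N {K₂} w := fun w => by
    rw [port_fan_eq b₀ _ w, hcol]
    intro a ha
    by_contra ha0
    have := hcol_ne a ha0
    omega
  have hport : ∀ w, port N (D₁' + D₂') w + (port N {K} w + port N {K₂} w) =
      port N ((K₂ ::ₘ E₁) + (K ::ₘ E₂)) w := by
    intro w
    have h1 := congrArg (port N · w) hZ₁
    have h2 := congrArg (port N · w) hZ₂
    simp only [trade, port_add, pa, pd, port_fan_eq_zero hrow', port_fan_eq_zero hcol'] at h1 h2 ⊢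
    omega
  have hnarrow' : ∀ J ∈ (fanRest φ Prod.fst x 0 + fan φ colOf x') +
      (fan φ Prod.fst x' + fanRest φ colOf x b₀), (J ∩ N).card ≤ 1 := by
    intro J hJ
    simp only [Multiset.mem_add, mem_fanRest, mem_fan] at hJ
    rcases hJ with (⟨a, ha, rfl⟩ | ⟨a, rfl⟩) | (⟨a, rfl⟩ | ⟨a, ha, rfl⟩)
    · exact hrow_ne a ha
    · exact hcol' a
    · exact hrow' a
    · exact hcol_ne a ha
  have hDsum : D₁' + D₂' = (E₁ + E₂) + ((fanRest φ Prod.fst x 0 + fan φ colOf x') +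
      (fan φ Prod.fst x' + fanRest φ colOf x b₀)) := by
    rw [hD₁', hD₂']
    abel
  have hnew : ∀ p, φ p ∉ X → p.1 ≠ 0 ∧ colOf p ≠ b₀ := fun p hp => by
    rw [hφX, not_or] at hp
    exact hp
  refine ⟨insert x' (X ∪ Finset.univ.image φ \ X), D₁', D₂', ?_, ?_, ?_, ?_⟩
  -- The hub x' is joined to all of K and K₂ except x. Only m lies in N and is free; every other
  -- such edge uses a port, which disappears with K or K₂.
  · refine h.exchange hq hι hφ hx hx' hxX hx'X hZ₁ hZ₂ ?_ ?_ (crossOrientation b₀) ?_ ?_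
      ?_ (fun u => if u = m then 1 else 0) (fun u => port N {K} u + port N {K₂} u)
      (fun u _ => (hport u).le) ?_ ?_ ?_ (Or.inr ?_)
    · intro J hJ
      rcases Multiset.mem_add.1 hJ with hJ | hJ
      · rw [Multiset.mem_singleton.1 hJ]
        exact hKX
      · rw [Multiset.mem_singleton.1 hJ]
        exact hK₂X
    · have hubcase : ∀ v, v ∈ X → x ≠ v → v ∉ N →
          cov (trade φ x x') x v = cov ({K} + {K₂}) x v := by
        intro v hv hxv hvN
        rw [cov_add, cov_singleton, cov_singleton]
        rcases trade_cases φ x x' v with rfl | rfl | ⟨p, rfl⟩ | ⟨h1, h2, h3⟩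
        · exact absurd rfl hxv
        · exact absurd hv hx'X
        · rw [cov_trade_hub hφ hx hxx]
          simp only [hpK, hpK₂, hxK, hxK₂, true_and]
          have h4 : ¬ (p.1 = 0 ∧ colOf p = b₀) := fun hh =>
            hvN (hKK₂ _ ((hpK p).2 hh.1) ((hpK₂ p).2 hh.2))
          have h5 := (hφX p).1 hv
          split_ifs <;> first | rfl | tauto
        · rw [cov_comm, cov_trade_other h1 h2 h3, if_neg, if_neg]
          · rintro ⟨-, hh⟩
            rw [← hcol, Finset.mem_insert] at hh
            rcases hh with hh | hh
            · exact h1 hh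
            · obtain ⟨p, -, hp⟩ := exists_of_mem_block hh
              exact h3 p hp
          · rintro ⟨-, hh⟩
            rw [← hrow, Finset.mem_insert] at hh
            rcases hh with hh | hh
            · exact h1 hh
            · obtain ⟨p, -, hp⟩ := exists_of_mem_block hh
              exact h3 p hp
      intro u hu v hv huv huvN
      by_cases hux : u = x
      · subst hux
        exact hubcase v hv huv fun hh => huvN ⟨hxN, hh⟩
      by_cases hvx : v = x
      · subst hvx
        rw [cov_comm, cov_comm _ u]
        exact hubcase u hu huv.symm fun hh => huvN ⟨hh, hxN⟩
      have hout : ∀ w, w ≠ x → (∀ p, φ p ≠ w) → w ∉ K ∧ w ∉ K₂ := by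
        intro w hwx hw
        rw [← hrow, ← hcol]
        simp only [Finset.mem_insert, hwx, false_or]
        refine ⟨fun hh => ?_, fun hh => ?_⟩ <;>
        · obtain ⟨p, -, hp⟩ := exists_of_mem_block hh
          exact hw p hp
      rw [cov_add, cov_singleton, cov_singleton]
      rcases trade_cases φ x x' u with rfl | rfl | ⟨p, rfl⟩ | ⟨h1, h2, h3⟩
      · exact absurd rfl hux
      · exact absurd hu hx'X
      · rcases trade_cases φ x x' v with rfl | rfl | ⟨p', rfl⟩ | ⟨h1, h2, h3⟩
        · exact absurd rfl hvx
        · exact absurd hv hx'X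
        · rw [cov_trade_pt hφ hx hx']
          simp only [hpK, hpK₂]
          have hne : ¬ (p.1 = p'.1 ∧ colOf p = colOf p') := fun hh =>
            huv (congrArg φ (colOf_injOn_row hh.1 hh.2))
          have h4 := (hφX p).1 hu
          have h5 := (hφX p').1 hv
          -- Row coincidences correspond to K and column coincidences to K₂: two old points in a
          -- common nonzero row would both lie in column b₀ and coincide, and symmetrically for
          -- columns.
          congr 1
          · refine if_congr ?_ rfl rfl
            constructor
            · intro hh
              by_contra hcon
              have h6 : p.1 ≠ 0 := fun h => hcon ⟨h, hh ▸ h⟩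
              have h7 : p'.1 ≠ 0 := fun h => hcon ⟨hh.trans h, h⟩
              exact hne ⟨hh, (h4.resolve_left h6).trans (h5.resolve_left h7).symm⟩
            · exact fun hh => hh.1.trans hh.2.symm
          · refine if_congr ?_ rfl rfl
            constructor
            · intro hh
              by_contra hcon
              have h6 : colOf p ≠ b₀ := fun h => hcon ⟨h, hh ▸ h⟩
              have h7 : colOf p' ≠ b₀ := fun h => hcon ⟨hh.trans h, h⟩
              exact hne ⟨(h4.resolve_right h6).trans (h5.resolve_right h7).symm, hh⟩
            · exact fun hh => hh.1.trans hh.2.symm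
        · have h4 := hout v h1 h3
          rw [cov_comm, cov_trade_other h1 h2 h3, if_neg (fun hh => h4.1 hh.2),
            if_neg (fun hh => h4.2 hh.2)]
      · have h4 := hout u h1 h3
        rw [cov_trade_other h1 h2 h3, if_neg (fun hh => h4.1 hh.1), if_neg (fun hh => h4.2 hh.1)]
    · intro p p' hp hp' hpp hh
      exact Nat.add_le_add (crossOrientation_pos hpp hh)
        (crossOrientation_pos hpp.symm (hh.imp Eq.symm Eq.symm))
    · intro p p' hp hp' hh
      have hpp : p' ≠ p := by
        rintro rfl
        exact hp hp'
      exact crossOrientation_root hpp.symm hh ((hφX p').1 hp')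
    · intro p hp
      have h1 := crossOrientation_sum_le (hnew p hp).1 (hnew p hp).2
      have h2 := hport (φ p)
      rw [port_eq_zero h.sub hp] at h2
      rw [← hb₀] at h1
      omega
    · intro u hu
      have h2 := hport u
      rw [port_eq_zero h.sub hu] at h2
      omega
    · intro p hp
      by_cases hpN : φ p ∈ N
      · have h1 : φ p = m := by rw [hφ0 p (hφN p hpN).1, (hφN p hpN).2, hs₀]
        simp [h1]
      · rcases (hφX p).1 hp with h0 | h0
        · have h1 : port N {K} (φ p) = 1 := by
            rw [port_singleton, if_pos ⟨(hpK p).2 h0, hpN, hK2⟩]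
          omega
        · have h1 : port N {K₂} (φ p) = 1 := by
            rw [port_singleton, if_pos ⟨(hpK₂ p).2 h0, hpN, hK₂2⟩]
          omega
    · rw [Finset.sum_ite_eq' X m, if_pos (h.base hmN)]
      omega
    · rw [Finset.sum_ite_eq' X m, if_pos (h.base hmN)]
  · intro J hJ
    rw [hDsum] at hJ
    rcases Multiset.mem_add.1 hJ with hJ | hJ
    · refine hnarrow J ?_
      rcases Multiset.mem_add.1 hJ with hJ | hJ <;> simp [hJ]
    · exact (hnarrow' J hJ).trans one_le_two
  · rw [hDsum]
    have h0 : wideCount N ((fanRest φ Prod.fst x 0 + fan φ colOf x') +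
        (fan φ Prod.fst x' + fanRest φ colOf x b₀)) = 0 := by
      refine Multiset.countP_eq_zero.2 fun J hJ => ?_
      have := hnarrow' J hJ
      omega
    unfold wideCount at h0 ⊢
    rw [Multiset.countP_add _ (E₁ + E₂), h0, Multiset.countP_add, Multiset.countP_add,
      Multiset.countP_cons, Multiset.countP_cons, if_pos hK2, if_pos hK₂2]
    omega
  · intro u v huv
    have h1 := congrArg (cov · u v) hZ₁
    have h2 := congrArg (cov · u v) hZ₂
    have h3 := cov_trade_swap hφ hx hx' hxx huv
    simp only [cov_add] at h1 h2
    omega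

/-! ### Divisible graphs as integer combinations of cliques -/

section Lattice

open Finset

variable {B : Type*} [AddCommGroup B]

/-- The number of pairs `u < v` in `S` related by `r`. -/
def pairCount (S : Finset ℕ) (r : ℕ → ℕ → Prop) [DecidableRel r] : ℕ :=
  ∑ u ∈ S, ∑ v ∈ S, if u < v ∧ r u v then 1 else 0

/-- The handshake identity with weights: A u is collected once from every related pair at u. -/
lemma sum_pairs_add {S : Finset ℕ} {r : ℕ → ℕ → Prop} [DecidableRel r]
    (hr : ∀ u v, r u v → r v u) (hirr : ∀ u, ¬ r u u) (A : ℕ → B) :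
    ∑ u ∈ S, ∑ v ∈ S, (if u < v ∧ r u v then A u + A v else 0) =
      ∑ u ∈ S, (S.filter (r u)).card • A u := by
  have h1 : ∑ u ∈ S, ∑ v ∈ S, (if u < v ∧ r u v then A u + A v else 0) =
      ∑ u ∈ S, ∑ v ∈ S, (if u < v ∧ r u v then A u else 0) +
      ∑ u ∈ S, ∑ v ∈ S, (if u < v ∧ r u v then A v else 0) := by
    simp only [← sum_add_distrib]
    refine sum_congr rfl fun u _ => sum_congr rfl fun v _ => ?_
    split_ifs <;> simp
  rw [h1, sum_comm (f := fun u v => if u < v ∧ r u v then A v else 0), ← sum_add_distrib]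
  refine sum_congr rfl fun u _ => ?_
  rw [← sum_add_distrib, ← sum_const, sum_filter]
  refine sum_congr rfl fun v _ => ?_
  have hsym : r v u ↔ r u v := ⟨hr v u, hr u v⟩
  rcases lt_trichotomy u v with h | rfl | h
  · simp [h, h.not_gt]
  · simp [hirr]
  · simp [h, h.not_gt, hsym]

lemma two_mul_pairCount {S : Finset ℕ} {r : ℕ → ℕ → Prop} [DecidableRel r]
    (hr : ∀ u v, r u v → r v u) (hirr : ∀ u, ¬ r u u) :
    2 * pairCount S r = ∑ u ∈ S, (S.filter (r u)).card := by
  have h := sum_pairs_add (B := ℤ) (S := S) hr hirr (fun _ => 1)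
  have h2 : (2 * pairCount S r : ℤ) = ∑ u ∈ S, ((S.filter (r u)).card : ℤ) := by
    simp only [nsmul_eq_mul, mul_one] at h
    rw [← h, pairCount]
    push_cast
    simp only [mul_sum]
    refine sum_congr rfl fun u _ => sum_congr rfl fun v _ => ?_
    split_ifs <;> simp
  exact_mod_cast h2

lemma sum_pairs_eq {S : Finset ℕ} {r : ℕ → ℕ → Prop} [DecidableRel r]
    (hr : ∀ u v, r u v → r v u) (hirr : ∀ u, ¬ r u u) {E : ℕ → ℕ → B} {A : ℕ → B} {τ : B}
    (hE : ∀ u ∈ S, ∀ v ∈ S, u ≠ v → E u v = A u + A v - τ) :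
    ∑ u ∈ S, ∑ v ∈ S, (if u < v ∧ r u v then E u v else 0) =
      ∑ u ∈ S, (S.filter (r u)).card • A u - pairCount S r • τ := by
  rw [← sum_pairs_add hr hirr, pairCount, sum_smul, ← sum_sub_distrib]
  refine sum_congr rfl fun u hu => ?_
  rw [sum_smul, ← sum_sub_distrib]
  refine sum_congr rfl fun v hv => ?_
  split_ifs with h
  · rw [hE u hu v hv h.1.ne, one_smul]
  · simp

/-- If `E` vanishes on all `q`-cliques and satisfies the alternating four-cycle relation, then it
vanishes on all divisible graphs. -/
theorem sum_pairs_eq_zero {q : ℕ} (hq : 2 ≤ q) {N : Finset ℕ} {E : ℕ → ℕ → B}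
    (hsymm : ∀ u v, E u v = E v u)
    (hclique : ∀ Q ⊆ N, Q.card = q → ∑ u ∈ Q, ∑ v ∈ Q, (if u < v ∧ u ≠ v then E u v else 0) = 0)
    (hcycle : ∀ u ∈ N, ∀ v ∈ N, ∀ w ∈ N, ∀ z ∈ N, u ≠ v → u ≠ w → u ≠ z → v ≠ w → v ≠ z → w ≠ z →
      E u v + E w z = E v w + E z u)
    {S : Finset ℕ} {a b : ℕ} (ha : a ∈ N) (hb : b ∈ N) (hab : a ≠ b)
    (hS : S ⊆ (N.erase a).erase b) (hN : q + 1 ≤ ((N.erase a).erase b).card)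
    {r : ℕ → ℕ → Prop} [DecidableRel r] (hr : ∀ u v, r u v → r v u) (hirr : ∀ u, ¬ r u u)
    (hdeg : ∀ u ∈ S, (q - 1) ∣ (S.filter (r u)).card) (hcount : q.choose 2 ∣ pairCount S r) :
    ∑ u ∈ S, ∑ v ∈ S, (if u < v ∧ r u v then E u v else 0) = 0 := by
  set N' := (N.erase a).erase b with hN'
  have hmem : ∀ u ∈ N', u ∈ N ∧ u ≠ a ∧ u ≠ b := fun u hu => by
    simp only [hN', mem_erase] at hu
    tauto
  obtain ⟨w₀, hw₀⟩ := card_pos.1 (show 0 < N'.card by omega)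
  obtain ⟨hw₀N, hw₀a, hw₀b⟩ := hmem w₀ hw₀
  -- By the four-cycle relation E v a - E v b does not depend on v. The second reference vertex b
  -- gives E u v = A u + A v - τ without halving in the group.
  set δ := E w₀ a - E w₀ b with hδ
  have hEb : ∀ v ∈ N', E v b = E v a - δ := by
    intro v hv
    obtain ⟨hvN, hva, hvb⟩ := hmem v hv
    rcases eq_or_ne v w₀ with rfl | hvw
    · rw [hδ]; abel
    · have h := hcycle v hvN a ha w₀ hw₀N b hb hva hvw hvb hw₀a.symm hab hw₀b
      rw [hsymm a w₀, hsymm b v] at h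
      rw [hδ, eq_sub_of_add_eq h]
      abel
  set τ := δ + E a b with hτ
  have hE : ∀ u ∈ N', ∀ v ∈ N', u ≠ v → E u v = E u a + E v a - τ := by
    intro u hu v hv huv
    obtain ⟨huN, hua, hub⟩ := hmem u hu
    obtain ⟨hvN, hva, hvb⟩ := hmem v hv
    have h := hcycle u huN v hvN a ha b hb huv hua hub hva hvb hab
    rw [hsymm b u, hEb u hu] at h
    rw [hτ, eq_sub_of_add_eq h]
    abel
  have hQ : ∀ Q ⊆ N', Q.card = q → ∑ u ∈ Q, (q - 1) • E u a = q.choose 2 • τ := by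
    intro Q hQN hQq
    have hd : ∀ u ∈ Q, (Q.filter (u ≠ ·)).card = q - 1 := fun u hu => by
      rw [← hQq, ← card_erase_of_mem hu]
      congr 1
      ext v
      simp only [mem_filter, mem_erase, and_comm, ne_comm]
    have h1 := hclique Q (fun u hu => (hmem u (hQN hu)).1) hQq
    have h3 := two_mul_pairCount (S := Q) (r := (· ≠ ·)) (fun u v h => h.symm) (fun u h => h rfl)
    rw [sum_pairs_eq (r := (· ≠ ·)) (fun u v h => h.symm) (fun u h => h rfl)
      fun u hu v hv => hE u (hQN hu) v (hQN hv)] at h1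
    rw [sum_congr rfl hd, sum_const, hQq, smul_eq_mul] at h3
    have h4 : pairCount Q (· ≠ ·) = q.choose 2 := by
      rw [Nat.choose_two_right, ← h3]
      omega
    rw [h4, sub_eq_zero] at h1
    rw [← h1]
    exact sum_congr rfl fun u hu => by rw [hd u hu]
  set g := (q - 1) • E w₀ a with hg
  have hAg : ∀ v ∈ N', (q - 1) • E v a = g := by
    intro v hv
    rcases eq_or_ne v w₀ with rfl | hvw
    · rfl
    -- Comparing two cliques that differ in one vertex shows that (q - 1) • E v a is constant; this
    -- needs q + 1 vertices.
    obtain ⟨R, hR, hRc⟩ := exists_subset_card_eq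
      (show q - 1 ≤ ((N'.erase v).erase w₀).card by
        rw [card_erase_of_mem (mem_erase.2 ⟨hvw.symm, hw₀⟩), card_erase_of_mem hv]
        omega)
    have hRN : R ⊆ N' := hR.trans ((erase_subset _ _).trans (erase_subset _ _))
    have hwR : w₀ ∉ R := fun h => notMem_erase _ _ (hR h)
    have hvR : v ∉ R := fun h => notMem_erase _ _ (mem_of_mem_erase (hR h))
    have h1 := hQ (insert v R) (insert_subset hv hRN) (by rw [card_insert_of_notMem hvR]; omega)
    have h2 := hQ (insert w₀ R) (insert_subset hw₀ hRN) (by rw [card_insert_of_notMem hwR]; omega)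
    rw [sum_insert hvR] at h1
    rw [sum_insert hwR, ← h1] at h2
    exact (add_right_cancel h2).symm
  have hqg : q • g = q.choose 2 • τ := by
    obtain ⟨Q, hQN, hQq⟩ := exists_subset_card_eq (show q ≤ N'.card by omega)
    rw [← hQ Q hQN hQq, sum_congr rfl fun u hu => hAg u (hQN hu), sum_const, hQq]
  rw [sum_pairs_eq hr hirr fun u hu v hv => hE u (hS hu) v (hS hv)]
  choose! k hk using hdeg
  obtain ⟨m, hm⟩ := hcount
  have h1 : ∑ u ∈ S, (S.filter (r u)).card • E u a = (∑ u ∈ S, k u) • g := by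
    rw [sum_smul]
    exact sum_congr rfl fun u hu => by rw [hk u hu, mul_comm, mul_smul, hAg u (hS hu)]
  -- The degree sum is twice m times `q.choose 2`, that is m q (q - 1). The vertex terms then give m
  -- q g, which cancels the edge term since q g equals `q.choose 2` times τ.
  have h2 : ∑ u ∈ S, k u = m * q := by
    have h3 := two_mul_pairCount (S := S) hr hirr
    rw [sum_congr rfl hk, ← mul_sum, hm, ← mul_assoc, Nat.choose_two_right,
      Nat.mul_div_cancel' (Nat.even_mul_pred_self q).two_dvd] at h3
    have h4 : (q - 1) * ∑ u ∈ S, k u = (q - 1) * (m * q) := by rw [← h3]; ring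
    exact Nat.eq_of_mul_eq_mul_left (by omega) h4
  rw [h1, h2, hm, mul_smul, hqg, mul_comm, mul_smul, sub_self]

/-- The indicator function of the pairs of distinct elements of `Q`. -/
def cliqueFun (Q : Finset ℕ) (s t : ℕ) : ℤ := if s ≠ t ∧ s ∈ Q ∧ t ∈ Q then 1 else 0

/-- The indicator function of the pair `{u, v}`. -/
def pairFun (u v s t : ℕ) : ℤ := if (s = u ∧ t = v) ∨ (s = v ∧ t = u) then 1 else 0

/-- The group generated by the `q`-cliques in `N`. -/
def cliqueLattice (q : ℕ) (N : Finset ℕ) : AddSubgroup (ℕ → ℕ → ℤ) :=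
  AddSubgroup.closure {g | ∃ Q ⊆ N, Q.card = q ∧ g = cliqueFun Q}

lemma cliqueFun_mem {q : ℕ} {N Q : Finset ℕ} (hQ : Q ⊆ N) (hq : Q.card = q) :
    cliqueFun Q ∈ cliqueLattice q N := AddSubgroup.subset_closure ⟨Q, hQ, hq, rfl⟩

lemma indicator_eq_sum {S : Finset ℕ} {r : ℕ → ℕ → Prop} [DecidableRel r]
    (hr : ∀ u v, r u v → r v u) (hirr : ∀ u, ¬ r u u) (hS : ∀ u v, r u v → u ∈ S) :
    (fun s t => if r s t then (1 : ℤ) else 0) =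
      ∑ u ∈ S, ∑ v ∈ S, if u < v ∧ r u v then pairFun u v else 0 := by
  have key : ∀ s t, s < t → (if r s t then (1 : ℤ) else 0) =
      ∑ u ∈ S, ∑ v ∈ S, (if u < v ∧ r u v then pairFun u v s t else 0) := by
    intro s t hst
    split_ifs with h
    · rw [sum_eq_single s, sum_eq_single t]
      · simp [hst, h, pairFun]
      · intro v _ hv
        simp [pairFun, hv.symm, hst.ne']
      · exact fun hh => absurd (hS t s (hr s t h)) hh
      · intro u _ hu
        refine sum_eq_zero fun v _ => ?_
        rw [ite_eq_right_iff]
        rintro ⟨huv, -⟩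
        rw [pairFun, if_neg]
        rintro (⟨h1, -⟩ | ⟨h1, h2⟩)
        · exact hu h1.symm
        · omega
      · exact fun hh => absurd (hS s t h) hh
    · symm
      refine sum_eq_zero fun u _ => sum_eq_zero fun v _ => ?_
      rw [ite_eq_right_iff]
      rintro ⟨huv, hruv⟩
      rw [pairFun, if_neg]
      rintro (⟨rfl, rfl⟩ | ⟨rfl, rfl⟩)
      · exact h hruv
      · exact h (hr _ _ hruv)
  have happ : ∀ s t, (∑ u ∈ S, ∑ v ∈ S, if u < v ∧ r u v then pairFun u v else 0) s t =
      ∑ u ∈ S, ∑ v ∈ S, (if u < v ∧ r u v then pairFun u v s t else 0) := by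
    intro s t
    simp only [Finset.sum_apply]
    refine sum_congr rfl fun u _ => sum_congr rfl fun v _ => ?_
    split_ifs <;> rfl
  funext s t
  rw [happ]
  rcases lt_trichotomy s t with h | rfl | h
  · exact key s t h
  · rw [if_neg (hirr s)]
    symm
    refine sum_eq_zero fun u _ => sum_eq_zero fun v _ => ?_
    rw [ite_eq_right_iff]
    rintro ⟨huv, -⟩
    rw [pairFun, if_neg]
    rintro (⟨rfl, rfl⟩ | ⟨rfl, rfl⟩) <;> exact lt_irrefl _ huv
  · have hsym : r s t ↔ r t s := ⟨hr s t, hr t s⟩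
    simp only [hsym]
    rw [key t s h]
    refine sum_congr rfl fun u _ => sum_congr rfl fun v _ => ?_
    simp only [pairFun, or_comm, and_comm]

/-- Off the diagonal a clique indicator is a product of sums of indicators. In the alternating sum
all terms involving R cancel, leaving the four edges of the cycle. -/
lemma pairFun_cycle {R : Finset ℕ} {u v w z : ℕ} (huv : u ≠ v) (hvw : v ≠ w) (hwz : w ≠ z)
    (hzu : z ≠ u) (hu : u ∉ R) (hv : v ∉ R) (hw : w ∉ R) (hz : z ∉ R) :
    pairFun u v + pairFun w z - (pairFun v w + pairFun z u) =
      cliqueFun (insert u (insert v R)) + cliqueFun (insert w (insert z R)) -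
      (cliqueFun (insert v (insert w R)) + cliqueFun (insert z (insert u R))) := by
  let χ : ℕ → ℤ := fun s => if s ∈ R then 1 else 0
  let e : ℕ → ℕ → ℤ := fun a s => if s = a then 1 else 0
  have hpair : ∀ a b s t, a ≠ b → pairFun a b s t = e a s * e b t + e b s * e a t := by
    intro a b s t hab
    simp only [pairFun, e]
    split_ifs <;> grind
  have hcl : ∀ a b s t, s ≠ t → a ≠ b → a ∉ R → b ∉ R → cliqueFun (insert a (insert b R)) s t =
      (χ s + e a s + e b s) * (χ t + e a t + e b t) := by
    have h1 : ∀ a b s, a ≠ b → a ∉ R → b ∉ R →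
        (if s ∈ insert a (insert b R) then (1 : ℤ) else 0) = χ s + e a s + e b s := by
      intro a b s hab ha hb
      simp only [mem_insert, χ, e]
      split_ifs <;> grind
    intro a b s t hst hab ha hb
    rw [← h1 a b s hab ha hb, ← h1 a b t hab ha hb, cliqueFun]
    simp only [hst, ne_eq, not_false_eq_true, true_and]
    split_ifs <;> simp_all
  funext s t
  simp only [Pi.add_apply, Pi.sub_apply]
  rcases eq_or_ne s t with rfl | hst
  · simp only [pairFun, cliqueFun, ne_eq, not_true_eq_false, false_and, if_false]
    rw [if_neg (by grind), if_neg (by grind), if_neg (by grind), if_neg (by grind)]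
  · rw [hpair u v s t huv, hpair w z s t hwz, hpair v w s t hvw, hpair z u s t hzu,
      hcl u v s t hst huv hu hv, hcl w z s t hst hwz hw hz, hcl v w s t hst hvw hv hw,
      hcl z u s t hst hzu hz hu]
    ring

/-- The indicator function of a `K_q`-divisible graph lies in the group generated by `q`-cliques
on a larger vertex set. -/
theorem indicator_mem_cliqueLattice {q : ℕ} (hq : 2 ≤ q) {N S : Finset ℕ} {a b : ℕ} (ha : a ∈ N)
    (hb : b ∈ N) (hab : a ≠ b) (hS : S ⊆ (N.erase a).erase b) (hN : q + 3 ≤ N.card)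
    {r : ℕ → ℕ → Prop} [DecidableRel r] (hr : ∀ u v, r u v → r v u) (hirr : ∀ u, ¬ r u u)
    (hrS : ∀ u v, r u v → u ∈ S)
    (hdeg : ∀ u ∈ S, (q - 1) ∣ (S.filter (r u)).card) (hcount : q.choose 2 ∣ pairCount S r) :
    (fun s t => if r s t then (1 : ℤ) else 0) ∈ cliqueLattice q N := by
  -- Membership becomes vanishing in the quotient, where `sum_pairs_eq_zero` applies to the classes
  -- of single pairs.
  let π := QuotientAddGroup.mk' (cliqueLattice q N)
  have hπ : ∀ g, π g = 0 ↔ g ∈ cliqueLattice q N := fun g => QuotientAddGroup.eq_zero_iff g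
  have hsum : ∀ (T : Finset ℕ) (r : ℕ → ℕ → Prop) [DecidableRel r],
      π (∑ u ∈ T, ∑ v ∈ T, if u < v ∧ r u v then pairFun u v else 0) =
      ∑ u ∈ T, ∑ v ∈ T, if u < v ∧ r u v then π (pairFun u v) else 0 := by
    intro T r _
    simp only [map_sum]
    refine sum_congr rfl fun u _ => sum_congr rfl fun v _ => ?_
    split_ifs
    · rfl
    · exact map_zero π
  rw [← hπ, indicator_eq_sum hr hirr hrS, hsum]
  refine sum_pairs_eq_zero hq (N := N) (E := fun u v => π (pairFun u v)) ?_ ?_ ?_ ha hb hab hS ?_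
    hr hirr hdeg hcount
  · intro u v
    congr 1
    funext s t
    simp only [pairFun, or_comm]
  · intro Q hQ hQq
    have h1 := indicator_eq_sum (S := Q) (r := fun s t => s ≠ t ∧ s ∈ Q ∧ t ∈ Q)
      (fun u v h => ⟨h.1.symm, h.2.2, h.2.1⟩) (fun u h => h.1 rfl) (fun u v h => h.2.1)
    have h2 := (hπ _).2 (cliqueFun_mem hQ hQq)
    have h3 : cliqueFun Q = fun s t => if s ≠ t ∧ s ∈ Q ∧ t ∈ Q then (1 : ℤ) else 0 := rfl
    rw [h3, h1, hsum] at h2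
    refine Eq.trans (sum_congr rfl fun u hu => sum_congr rfl fun v hv => ?_) h2
    simp [hu, hv]
  · intro u hu v hv w hw z hz huv huw huz hvw hvz hwz
    obtain ⟨R, hR, hRc⟩ := exists_subset_card_eq
      (show q - 2 ≤ ((((N.erase u).erase v).erase w).erase z).card by
        have h1 := pred_card_le_card_erase (s := N) (a := u)
        have h2 := pred_card_le_card_erase (s := N.erase u) (a := v)
        have h3 := pred_card_le_card_erase (s := (N.erase u).erase v) (a := w)
        have h4 := pred_card_le_card_erase (s := ((N.erase u).erase v).erase w) (a := z)
        omega)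
    have hRm : ∀ s ∈ R, s ∈ N ∧ s ≠ u ∧ s ≠ v ∧ s ≠ w ∧ s ≠ z := fun s hs => by
      have := hR hs
      simp only [mem_erase] at this
      tauto
    have hcl : ∀ c ∈ N, ∀ d ∈ N, c ≠ d → c ∉ R → d ∉ R →
        cliqueFun (insert c (insert d R)) ∈ cliqueLattice q N := by
      intro c hc d hd hcd hcR hdR
      refine cliqueFun_mem (insert_subset hc (insert_subset hd fun s hs => (hRm s hs).1)) ?_
      rw [card_insert_of_notMem, card_insert_of_notMem hdR]
      · omega
      · simp [hcd, hcR]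
    have huR : u ∉ R := fun h => (hRm u h).2.1 rfl
    have hvR : v ∉ R := fun h => (hRm v h).2.2.1 rfl
    have hwR : w ∉ R := fun h => (hRm w h).2.2.2.1 rfl
    have hzR : z ∉ R := fun h => (hRm z h).2.2.2.2 rfl
    have h := pairFun_cycle huv hvw hwz huz.symm huR hvR hwR hzR
    rw [← sub_eq_zero, ← map_add, ← map_add, ← map_sub, hπ, h]
    exact sub_mem (add_mem (hcl u hu v hv huv huR hvR) (hcl w hw z hz hwz hwR hzR))
      (add_mem (hcl v hv w hw hvw hvR hwR) (hcl z hz u hu huz.symm hzR huR))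
  · rw [card_erase_of_mem (mem_erase.2 ⟨hab.symm, hb⟩), card_erase_of_mem ha]
    omega

end Lattice

/-! ### Realising lattice elements by balanced pairs -/

lemma cov_cons (K : Finset ℕ) (D : Multiset (Finset ℕ)) (u v : ℕ) :
    cov (K ::ₘ D) u v = cov D u v + if u ∈ K ∧ v ∈ K then 1 else 0 := by
  rw [← Multiset.singleton_add, cov_add, cov_singleton, add_comm]

theorem IsBalancedPair.empty {q : ℕ} (N : Finset ℕ) : IsBalancedPair q N N 0 0 where
  base := subset_rfl
  sub := by simp
  card_eq := by simp
  bal _ _ _ _ := rfl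
  le_one _ _ _ _ := by simp [cov]
  port_le _ := by simp [port]
  sparse := by
    have h : ∀ S, pairSum (adjOf N 0) S = 0 := fun S => by simp [pairSum, adjOf, cov]
    refine ⟨fun S _ => ?_, fun S _ hS => ?_, fun S _ hS => ?_⟩
    · simp [h, port]
    · rw [h]
      nlinarith
    · simp only [h, port, add_zero, Multiset.countP_zero, Finset.sum_const_zero, mul_zero, zero_add]
      nlinarith

/-- A clique inside `N` may be added to one side. -/
theorem IsBalancedPair.cons {q : ℕ} {N X Q : Finset ℕ} {D₁ D₂ : Multiset (Finset ℕ)}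
    (h : IsBalancedPair q N X D₁ D₂) (hQ : Q ⊆ N) (hQq : Q.card = q) :
    IsBalancedPair q N X D₁ (Q ::ₘ D₂) := by
  have hport : port N (D₁ + Q ::ₘ D₂) = port N (D₁ + D₂) := by
    funext w
    rw [← Multiset.singleton_add, port_add, port_add, port_add, port_singleton, if_neg, zero_add]
    exact fun hw => hw.2.1 (hQ hw.1)
  refine ⟨h.base, fun K hK => ?_, fun K hK => ?_, fun u v huv hN => ?_, h.le_one, ?_, ?_⟩
  · rw [Multiset.add_cons, Multiset.mem_cons] at hK
    rcases hK with rfl | hK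
    · exact hQ.trans h.base
    · exact h.sub K hK
  · rw [Multiset.add_cons, Multiset.mem_cons] at hK
    rcases hK with rfl | hK
    · exact hQq
    · exact h.card_eq K hK
  · rw [cov_cons, if_neg fun hh => hN ⟨hQ hh.1, hQ hh.2⟩, h.bal u v huv hN, add_zero]
  · rw [hport]
    exact h.port_le
  · rw [hport]
    exact h.sparse

/-- A wide member of `D₂` can be replaced by members with at most two vertices in `N`. -/
theorem IsBalancedPair.exists_narrow {q : ℕ} (hq : 4 ≤ q) {N : Finset ℕ} (k : ℕ) :
    ∀ {X K : Finset ℕ} {D₁ E : Multiset (Finset ℕ)}, IsBalancedPair q N X D₁ (K ::ₘ E) →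
      (∀ J ∈ D₁ + E, (J ∩ N).card ≤ 2) → (K ∩ N).card ≤ k →
      ∃ X' D₁' D₂', IsBalancedPair q N X' D₁' D₂' ∧ (∀ J ∈ D₁' + D₂', (J ∩ N).card ≤ 2) ∧
        ∀ u v, u ≠ v → cov D₁ u v + cov D₂' u v = cov D₁' u v + cov (K ::ₘ E) u v := by
  induction k with
  | zero =>
    intro X K D₁ E h hn hK
    refine ⟨X, D₁, K ::ₘ E, h, fun J hJ => ?_, fun u v _ => rfl⟩
    rw [Multiset.add_cons, Multiset.mem_cons] at hJ
    rcases hJ with rfl | hJ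
    · omega
    · exact hn J hJ
  | succ k ih =>
    intro X K D₁ E h hn hK
    rcases Nat.lt_or_ge 2 (K ∩ N).card with h3 | h3
    · obtain ⟨X', K', D₁', E', h', hn', hc, hcov⟩ := h.reduce hq hn h3
      obtain ⟨X'', D₁'', D₂'', h'', hn'', hcov'⟩ := ih h' hn' (by omega)
      refine ⟨X'', D₁'', D₂'', h'', hn'', fun u v huv => ?_⟩
      have := hcov u v huv
      have := hcov' u v huv
      omega
    · refine ⟨X, D₁, K ::ₘ E, h, fun J hJ => ?_, fun u v _ => rfl⟩
      rw [Multiset.add_cons, Multiset.mem_cons] at hJ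
      rcases hJ with rfl | hJ
      · exact h3
      · exact hn J hJ

/-- `f` is the imbalance on `N` of some balanced pair all of whose members have at most two
vertices in `N`. -/
def IsImbalance (q : ℕ) (N : Finset ℕ) (f : ℕ → ℕ → ℤ) : Prop :=
  ∃ X D₁ D₂, IsBalancedPair q N X D₁ D₂ ∧ (∀ J ∈ D₁ + D₂, (J ∩ N).card ≤ 2) ∧
    ∀ u ∈ N, ∀ v ∈ N, u ≠ v → (cov D₂ u v : ℤ) = cov D₁ u v + f u v

lemma IsImbalance.zero {q : ℕ} {N : Finset ℕ} : IsImbalance q N 0 :=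
  ⟨N, 0, 0, .empty N, by simp, fun u _ v _ _ => by simp⟩

lemma IsImbalance.neg {q : ℕ} {N : Finset ℕ} {f : ℕ → ℕ → ℤ} (h : IsImbalance q N f) :
    IsImbalance q N (-f) := by
  obtain ⟨X, D₁, D₂, h, hn, hf⟩ := h
  refine ⟨X, D₂, D₁, h.symm, by rwa [add_comm], fun u hu v hv huv => ?_⟩
  rw [hf u hu v hv huv]
  simp

lemma IsImbalance.add_cliqueFun {q : ℕ} (hq : 4 ≤ q) {N Q : Finset ℕ} {f : ℕ → ℕ → ℤ}
    (h : IsImbalance q N f) (hQ : Q ⊆ N) (hQq : Q.card = q) :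
    IsImbalance q N (f + cliqueFun Q) := by
  obtain ⟨X, D₁, D₂, h, hn, hf⟩ := h
  obtain ⟨X', D₁', D₂', h', hn', hcov⟩ := (h.cons hQ hQq).exists_narrow hq _ hn le_rfl
  refine ⟨X', D₁', D₂', h', hn', fun u hu v hv huv => ?_⟩
  have h1 := hf u hu v hv huv
  have h2 := hcov u v huv
  rw [cov_cons] at h2
  simp only [Pi.add_apply, cliqueFun, huv, ne_eq, not_false_eq_true, true_and]
  split_ifs at h2 ⊢ <;> omega

/-- The claim for every f makes it pass through sums. Subtraction of a clique is its addition after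
the two families exchange roles. -/
lemma IsImbalance.add_of_mem {q : ℕ} (hq : 4 ≤ q) {N : Finset ℕ} {g : ℕ → ℕ → ℤ}
    (hg : g ∈ cliqueLattice q N) : ∀ f, IsImbalance q N f → IsImbalance q N (f + g) := by
  induction hg using AddSubgroup.closure_induction with
  | mem g hg =>
    obtain ⟨Q, hQ, hQq, rfl⟩ := hg
    exact fun f hf => hf.add_cliqueFun hq hQ hQq
  | zero => exact fun f hf => by rwa [add_zero]
  | add g g' _ _ ih ih' => exact fun f hf => by rw [← add_assoc]; exact ih' _ (ih f hf)
  | neg g _ ih =>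
    intro f hf
    have := (ih _ hf.neg).neg
    rwa [neg_add, neg_neg] at this

/-- If the imbalance is nonnegative, all pairs inside `N` can be removed from `D₁`. -/
theorem IsBalancedPair.exists_closed {q : ℕ} (hq : 4 ≤ q) {N : Finset ℕ} {f : ℕ → ℕ → ℤ}
    (hf : ∀ u v, 0 ≤ f u v) (k : ℕ) :
    ∀ {X : Finset ℕ} {D₁ D₂ : Multiset (Finset ℕ)}, IsBalancedPair q N X D₁ D₂ →
      (∀ J ∈ D₁ + D₂, (J ∩ N).card ≤ 2) →
      (∀ u ∈ N, ∀ v ∈ N, u ≠ v → (cov D₂ u v : ℤ) = cov D₁ u v + f u v) →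
      wideCount N (D₁ + D₂) < k →
      ∃ X' D₁' D₂', IsBalancedPair q N X' D₁' D₂' ∧
        ∀ u ∈ N, ∀ v ∈ N, u ≠ v → cov D₁' u v = 0 ∧ (cov D₂' u v : ℤ) = f u v := by
  induction k with
  | zero => exact fun _ _ _ hk => absurd hk (Nat.not_lt_zero _)
  | succ k ih =>
    intro X D₁ D₂ h hn hcov hk
    by_cases h0 : ∀ u ∈ N, ∀ v ∈ N, u ≠ v → cov D₁ u v = 0
    · refine ⟨X, D₁, D₂, h, fun u hu v hv huv => ⟨h0 u hu v hv huv, ?_⟩⟩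
      rw [hcov u hu v hv huv, h0 u hu v hv huv]
      simp
    push Not at h0
    obtain ⟨u, hu, v, hv, huv, hpos⟩ := h0
    -- As f is nonnegative, a pair covered by D₁ is also covered by D₂, so `close` has both cliques
    -- it needs.
    have hpos₂ : 0 < cov D₂ u v := by
      have h1 := hcov u hu v hv huv
      have h2 := hf u v
      omega
    obtain ⟨K₂, hK₂, huK₂, hvK₂⟩ := Multiset.countP_pos.1 (Nat.pos_of_ne_zero hpos)
    obtain ⟨K, hK, huK, hvK⟩ := Multiset.countP_pos.1 hpos₂
    obtain ⟨E₁, rfl⟩ := Multiset.exists_cons_of_mem hK₂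
    obtain ⟨E₂, rfl⟩ := Multiset.exists_cons_of_mem hK
    obtain ⟨X', D₁', D₂', h', hn', hw, hcov'⟩ := h.close hq hn huv hu hv huK hvK huK₂ hvK₂
    refine ih h' hn' (fun s hs t ht hst => ?_) (by omega)
    have h1 := hcov s hs t ht hst
    have h2 := hcov' s t hst
    omega

/-- Every nonnegative element of the lattice is the imbalance of a balanced pair whose first
component covers no pair inside `N`. -/
theorem exists_balancedPair {q : ℕ} (hq : 4 ≤ q) {N : Finset ℕ} {f : ℕ → ℕ → ℤ}
    (hf : ∀ u v, 0 ≤ f u v) (hmem : f ∈ cliqueLattice q N) :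
    ∃ X D₁ D₂, IsBalancedPair q N X D₁ D₂ ∧
      ∀ u ∈ N, ∀ v ∈ N, u ≠ v → cov D₁ u v = 0 ∧ (cov D₂ u v : ℤ) = f u v := by
  obtain ⟨X, D₁, D₂, h, hn, hcov⟩ := IsImbalance.add_of_mem hq hmem 0 .zero
  rw [zero_add] at hcov
  exact h.exists_closed hq hf _ hn hcov (Nat.lt_succ_self _)

/-! ### From covered pairs to graphs and densities -/

section Graph

variable {q : ℕ} {N X : Finset ℕ} {D₁ D₂ : Multiset (Finset ℕ)}

/-- The graph of the pairs covered by `D`. -/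
def coverGraph (X : Finset ℕ) (D : Multiset (Finset ℕ)) : SimpleGraph X where
  Adj u v := u ≠ v ∧ cov D u v ≠ 0
  symm := ⟨fun u v h => ⟨h.1.symm, by rw [cov_comm]; exact h.2⟩⟩
  loopless := ⟨fun u h => h.1 rfl⟩

lemma coverGraph_hasCliqueDecomposition {D : Multiset (Finset ℕ)} (hsub : ∀ K ∈ D, K ⊆ X)
    (hcard : ∀ K ∈ D, K.card = q) (hle : ∀ u v, u ≠ v → cov D u v ≤ 1) :
    HasCliqueDecomposition q (coverGraph X D) := by
  classical
  refine ⟨{J | ∃ K ∈ D, J = K.subtype (· ∈ X)}, ?_, ?_⟩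
  · rintro _ ⟨K, hK, rfl⟩
    refine ⟨fun u hu v hv huv => ⟨huv, ?_⟩, ?_⟩
    · have hu' : (u : ℕ) ∈ K := by simpa using hu
      have hv' : (v : ℕ) ∈ K := by simpa using hv
      exact (Multiset.countP_pos.2 ⟨K, hK, hu', hv'⟩).ne'
    · rw [Finset.card_subtype, Finset.filter_true_of_mem fun u hu => hsub K hK hu, hcard K hK]
  · rintro u v ⟨huv, hc⟩
    obtain ⟨K, hK, huK, hvK⟩ := Multiset.countP_pos.1 (Nat.pos_of_ne_zero hc)
    refine ⟨K.subtype (· ∈ X), ⟨⟨K, hK, rfl⟩, by simpa using huK, by simpa using hvK⟩, ?_⟩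
    rintro _ ⟨⟨J, hJ, rfl⟩, huJ, hvJ⟩
    simp only [Finset.mem_subtype] at huJ hvJ
    obtain ⟨E, rfl⟩ := Multiset.exists_cons_of_mem hK
    rcases Multiset.mem_cons.1 hJ with rfl | hJ
    · rfl
    · have h1 := hle u v fun h => huv (Subtype.ext h)
      rw [cov_cons, if_pos ⟨huK, hvK⟩] at h1
      have h2 : 0 < cov E u v := Multiset.countP_pos.2 ⟨J, hJ, huJ, hvJ⟩
      omega

/-- No pair inside N is covered by D₁, so `adjOf`, which ignores such pairs, misses no edge. -/
lemma two_mul_ncard_edgeSet_le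
    (h₀ : ∀ u ∈ N, ∀ v ∈ N, u ≠ v → cov D₁ u v = 0) (H : (coverGraph X D₁).Subgraph)
    {S : Finset ℕ} (hS : ∀ u : X, (u : ℕ) ∈ S ↔ u ∈ H.verts) (hSX : S ⊆ X) :
    2 * H.edgeSet.ncard ≤ pairSum (adjOf N D₁) S := by
  classical
  have h1 : H.edgeSet = H.spanningCoe.edgeSet := by
    ext e
    induction e with
    | _ u v => simp
  have h2 := H.spanningCoe.sum_degrees_eq_twice_card_edges
  rw [h1, Set.ncard_eq_toFinset_card', ← SimpleGraph.edgeFinset, ← h2]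
  have h3 : ∀ u : X, H.spanningCoe.degree u ≤ if (u : ℕ) ∈ S then ∑ v ∈ S, adjOf N D₁ u v else 0 := by
    intro u
    split_ifs with hu
    · rw [← SimpleGraph.card_neighborFinset_eq_degree, Finset.card_eq_sum_ones]
      have h4 : ∀ v ∈ H.spanningCoe.neighborFinset u, 1 ≤ adjOf N D₁ u v := by
        intro v hv
        rw [SimpleGraph.mem_neighborFinset] at hv
        have h5 := H.adj_sub hv
        have huv : (u : ℕ) ≠ v := fun hh => h5.1 (Subtype.ext hh)
        rw [adjOf, if_pos ⟨huv, fun hh => h5.2 (h₀ _ hh.1 _ hh.2 huv)⟩]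
        exact Nat.pos_of_ne_zero h5.2
      refine (Finset.sum_le_sum h4).trans ?_
      refine (Finset.sum_map (H.spanningCoe.neighborFinset u) (Function.Embedding.subtype _)
        fun v => adjOf N D₁ u v).symm.trans_le (Finset.sum_le_sum_of_subset ?_)
      intro v hv
      obtain ⟨v, hv', rfl⟩ := Finset.mem_map.1 hv
      rw [SimpleGraph.mem_neighborFinset] at hv'
      exact (hS v).2 (H.edge_vert hv'.symm)
    · rw [Nat.le_zero, ← SimpleGraph.card_neighborFinset_eq_degree, Finset.card_eq_zero,
        Finset.eq_empty_iff_forall_notMem]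
      intro v hv
      rw [SimpleGraph.mem_neighborFinset] at hv
      exact hu ((hS u).2 (H.edge_vert hv))
  refine (Finset.sum_le_sum fun u _ => h3 u).trans ?_
  rw [Finset.univ_eq_attach, Finset.sum_attach X fun u => if u ∈ S then ∑ v ∈ S, adjOf N D₁ u v else 0,
    Finset.sum_ite_mem, Finset.inter_eq_right.2 hSX]
  rfl

end Graph

section Density

variable {q : ℕ} {N X : Finset ℕ} {D₁ D₂ : Multiset (Finset ℕ)}

lemma IsBalancedPair.maxRootedTwoDensity_le (h : IsBalancedPair q N X D₁ D₂)
    (h₀ : ∀ u ∈ N, ∀ v ∈ N, u ≠ v → cov D₁ u v = 0) {R : Set X} (hR : ∀ u ∈ R, (u : ℕ) ∈ N) :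
    maxRootedTwoDensity (coverGraph X D₁) R ≤ (((q : ℝ) + 1 / 2 : ℝ) : EReal) := by
  classical
  have key : ∀ H : (coverGraph X D₁).Subgraph, ∃ S ⊆ X, (∀ u : X, (u : ℕ) ∈ S ↔ u ∈ H.verts) ∧
      S.card = H.verts.ncard ∧ (S \ N).card ≤ (H.verts \ R).ncard ∧
      2 * H.edgeSet.ncard ≤ pairSum (adjOf N D₁) S := by
    intro H
    set S : Finset ℕ := H.verts.toFinset.map (Function.Embedding.subtype _) with hS
    have hmem : ∀ u : X, (u : ℕ) ∈ S ↔ u ∈ H.verts := by simp [hS]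
    have hSX : S ⊆ X := by
      intro u hu
      obtain ⟨v, -, rfl⟩ := Finset.mem_map.1 hu
      exact v.2
    refine ⟨S, hSX, hmem, ?_, ?_, two_mul_ncard_edgeSet_le h₀ H hmem hSX⟩
    · rw [hS, Finset.card_map, Set.ncard_eq_toFinset_card']
    · have h1 : S \ N ⊆ (H.verts \ R).toFinset.map (Function.Embedding.subtype _) := by
        intro u hu
        rw [Finset.mem_sdiff] at hu
        refine Finset.mem_map.2 ⟨⟨u, hSX hu.1⟩, ?_, rfl⟩
        rw [Set.mem_toFinset]
        exact ⟨(hmem _).1 hu.1, fun hh => hu.2 (hR _ hh)⟩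
      refine (Finset.card_le_card h1).trans ?_
      rw [Finset.card_map, Set.ncard_eq_toFinset_card']
  refine max_le (iSup₂_le fun H hH => ?_) (iSup₂_le fun H hH => ?_)
  · obtain ⟨S, hSX, -, -, hN, he⟩ := key H
    have hpos : 0 < (H.verts \ R).ncard := (Set.ncard_pos (Set.toFinite _)).2 hH
    have h1 := h.sparse.rooted S hSX
    have h2 : 2 * H.edgeSet.ncard ≤ (2 * q + 1) * (H.verts \ R).ncard := by
      have := Nat.mul_le_mul_left (2 * q + 1) hN
      omega
    have h3 : (2 * H.edgeSet.ncard : ℝ) ≤ (2 * q + 1) * (H.verts \ R).ncard := by exact_mod_cast h2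
    rw [EReal.coe_le_coe_iff, div_le_iff₀ (by exact_mod_cast hpos)]
    linarith
  · obtain ⟨S, hSX, -, hcard, -, he⟩ := key H
    have h1 := h.sparse.two S hSX (by omega)
    rw [hcard] at h1
    have h2 : (2 * H.edgeSet.ncard + 4 * q : ℝ) ≤ (2 * q + 1) * H.verts.ncard := by
      exact_mod_cast (Nat.add_le_add_right he _).trans h1
    have h3 : (3 : ℝ) ≤ H.verts.ncard := by exact_mod_cast hH
    rw [EReal.coe_le_coe_iff, div_le_iff₀ (by linarith)]
    linarith

end Density

/-! ### Construction of the absorber -/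

section Absorber

lemma card_filter_map_adj {k : ℕ} (L : SimpleGraph (Fin k))
    [DecidableRel (L.map Fin.valEmbedding).Adj] (u : Fin k) :
    ((Finset.range k).filter ((L.map Fin.valEmbedding).Adj u)).card = (L.neighborSet u).ncard := by
  rw [← Set.ncard_image_of_injective (L.neighborSet u) Fin.val_injective, ← Set.ncard_coe_finset]
  congr 1
  ext v
  simp only [Finset.coe_filter, Finset.mem_range, Set.mem_ofPred_eq, Set.mem_image,
    SimpleGraph.mem_neighborSet]
  constructor
  · rintro ⟨-, -, u', v', h, hu, rfl⟩
    obtain rfl := Fin.val_injective hu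
    exact ⟨v', h, rfl⟩
  · rintro ⟨v, h, rfl⟩
    exact ⟨v.2, fun hh => h.ne (Fin.val_injective hh), u, v, h, rfl, rfl⟩

lemma pairCount_map_adj {k : ℕ} (L : SimpleGraph (Fin k))
    [DecidableRel (L.map Fin.valEmbedding).Adj] :
    pairCount (Finset.range k) (L.map Fin.valEmbedding).Adj = L.edgeSet.ncard := by
  classical
  have h1 := two_mul_pairCount (S := Finset.range k) (r := (L.map Fin.valEmbedding).Adj)
    (fun u v h => h.symm) fun u => SimpleGraph.irrefl _
  have h2 := L.sum_degrees_eq_twice_card_edges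
  have h3 : ∑ u ∈ Finset.range k,
      ((Finset.range k).filter ((L.map Fin.valEmbedding).Adj u)).card = ∑ u, L.degree u := by
    rw [Finset.sum_range]
    refine Finset.sum_congr rfl fun u _ => ?_
    rw [card_filter_map_adj, Set.ncard_eq_toFinset_card', ← SimpleGraph.card_neighborFinset_eq_degree]
    rfl
  rw [Set.ncard_eq_toFinset_card', ← SimpleGraph.edgeFinset]
  omega

/-- Every `K_q`-divisible graph on `Fin k` has an absorber of rooted `2`-density at most
`q + 1 / 2`. -/
theorem exists_absorber_fin {q : ℕ} (hq : 4 ≤ q) {k : ℕ} (L : SimpleGraph (Fin k))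
    (hL : IsCliqueDivisible q L) :
    ∃ (W : Type) (_ : Finite W) (f : Fin k ↪ W) (A : SimpleGraph W), IsCliqueAbsorber q L f A ∧
      maxRootedTwoDensity A (Set.range f) ≤ (((q : ℝ) + 1 / 2 : ℝ) : EReal) := by
  classical
  set G := L.map Fin.valEmbedding with hG
  have hGlt : ∀ {u v}, G.Adj u v → u < k := by
    rintro _ _ ⟨-, u, v, -, rfl, -⟩
    exact u.2
  -- The vertices k and k + 1 outside the copy of L serve as reference vertices, and k + q + 5
  -- exceeds the required q + 3.
  have hmem := indicator_mem_cliqueLattice (q := q) (by omega) (N := Finset.range (k + q + 5))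
    (S := Finset.range k) (a := k) (b := k + 1) (by simp; omega) (by simp; omega) (by omega)
    (fun u hu => by simp only [Finset.mem_erase, Finset.mem_range] at hu ⊢; omega)
    (by simp; omega) (r := G.Adj) (fun u v h => h.symm) (fun u => SimpleGraph.irrefl _)
    (fun u v h => Finset.mem_range.2 (hGlt h))
    (fun u hu => by
      have := card_filter_map_adj L ⟨u, Finset.mem_range.1 hu⟩
      exact this ▸ hL.2 _)
    (by rw [pairCount_map_adj]; exact hL.1)
  obtain ⟨X, D₁, D₂, h, hcov⟩ := exists_balancedPair hq
    (fun u v => by beta_reduce; split_ifs <;> norm_num) hmem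
  set N := Finset.range (k + q + 5) with hN
  have hkN : ∀ u : Fin k, (u : ℕ) ∈ N := fun u => by rw [hN, Finset.mem_range]; omega
  let f : Fin k ↪ X := ⟨fun u => ⟨u, h.base (hkN u)⟩, fun u v huv => by simpa [Fin.ext_iff] using huv⟩
  have hle₁ : ∀ u v, u ≠ v → cov D₁ u v ≤ 1 := by
    intro u v huv
    by_cases hu : u ∈ N ∧ v ∈ N
    · rw [(hcov u hu.1 v hu.2 huv).1]
      exact zero_le_one
    · exact h.le_one u v huv hu
  have hle₂ : ∀ u v, u ≠ v → cov D₂ u v ≤ 1 := by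
    intro u v huv
    by_cases hu : u ∈ N ∧ v ∈ N
    · have h1 := (hcov u hu.1 v hu.2 huv).2
      split_ifs at h1 <;> omega
    · rw [← h.bal u v huv hu]
      exact h.le_one u v huv hu
  have hunion : L.map f ⊔ coverGraph X D₁ = coverGraph X D₂ := by
    have hmap : ∀ u v : X, (L.map f).Adj u v ↔ G.Adj u v := by
      intro u v
      constructor
      · rintro ⟨huv, a, b, hab, rfl, rfl⟩
        exact ⟨fun hh => huv (Subtype.ext hh), a, b, hab, rfl, rfl⟩
      · rintro ⟨huv, a, b, hab, ha, hb⟩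
        exact ⟨fun hh => huv (congrArg _ hh), a, b, hab, Subtype.ext ha, Subtype.ext hb⟩
    ext u v
    rw [SimpleGraph.sup_adj, hmap]
    by_cases huv : u = v
    · subst huv
      simp
    have huv' : (u : ℕ) ≠ v := fun hh => huv (Subtype.ext hh)
    change _ ∨ (u ≠ v ∧ _) ↔ u ≠ v ∧ _
    by_cases hu : (u : ℕ) ∈ N ∧ (v : ℕ) ∈ N
    · obtain ⟨h1, h2⟩ := hcov u hu.1 v hu.2 huv'
      by_cases ha : G.Adj u v
      · rw [if_pos ha] at h2
        exact iff_of_true (Or.inl ha) ⟨huv, by omega⟩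
      · rw [if_neg ha] at h2
        refine iff_of_false ?_ fun hh => hh.2 (by omega)
        rintro (hh | hh)
        · exact ha hh
        · exact hh.2 h1
    · rw [h.bal u v huv' hu]
      refine or_iff_right fun ha => hu ⟨?_, ?_⟩
      · exact hkN ⟨u, hGlt ha⟩
      · exact hkN ⟨v, hGlt ha.symm⟩
  refine ⟨X, inferInstance, f, coverGraph X D₁, ⟨?_, ?_, ?_⟩,
    h.maxRootedTwoDensity_le (fun u hu v hv huv => (hcov u hu v hv huv).1) ?_⟩
  · rintro _ ⟨u, rfl⟩ _ ⟨v, rfl⟩ huv hadj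
    exact hadj.2 (hcov u (hkN u) v (hkN v) fun hh => huv (Subtype.ext hh)).1
  · exact coverGraph_hasCliqueDecomposition h.sub₁
      (fun K hK => h.card_eq K (Multiset.mem_add.2 (Or.inl hK))) hle₁
  · rw [hunion]
    exact coverGraph_hasCliqueDecomposition h.sub₂
      (fun K hK => h.card_eq K (Multiset.mem_add.2 (Or.inr hK))) hle₂
  · rintro _ ⟨u, rfl⟩
    exact hkN u

lemma IsCliqueDivisible.map {q : ℕ} {V V' : Type} {L : SimpleGraph V} (h : IsCliqueDivisible q L)
    (e : V ≃ V') : IsCliqueDivisible q (L.map e.toEmbedding) := by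
  let φ := SimpleGraph.Iso.map e L
  refine ⟨?_, fun v => ?_⟩
  · have h1 := Nat.card_congr φ.mapEdgeSet
    rw [Nat.card_coe_set_eq, Nat.card_coe_set_eq] at h1
    exact h1 ▸ h.1
  · have h1 := Nat.card_congr (φ.mapNeighborSet (e.symm v))
    rw [Nat.card_coe_set_eq, Nat.card_coe_set_eq] at h1
    have h2 : φ (e.symm v) = v := e.apply_symm_apply v
    rw [h2] at h1
    exact h1 ▸ h.2 _

theorem hasAbsorbersOfTwoDensity {q : ℕ} (hq : 4 ≤ q) :
    HasAbsorbersOfTwoDensity q ((q : ℝ) + 1 / 2) := by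
  classical
  have hfin : ∀ p : Σ k : ℕ, SimpleGraph (Fin k), ∃ n : ℕ, IsCliqueDivisible q p.2 →
      ∃ (W : Type) (_ : Finite W) (f : Fin p.1 ↪ W) (A : SimpleGraph W),
        Nat.card W ≤ n ∧ IsCliqueAbsorber q p.2 f A ∧
          maxRootedTwoDensity A (Set.range f) ≤ (((q : ℝ) + 1 / 2 : ℝ) : EReal) := by
    intro p
    by_cases hp : IsCliqueDivisible q p.2
    · obtain ⟨W, hW, f, A, hA⟩ := exists_absorber_fin hq p.2 hp
      exact ⟨Nat.card W, fun _ => ⟨W, hW, f, A, le_rfl, hA⟩⟩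
    · exact ⟨0, fun hh => absurd hh hp⟩
  choose n hn using hfin
  intro C₁ _
  -- Up to isomorphism only finitely many graphs L occur, so the absorber sizes can simply be added
  -- up.
  refine ⟨∑ k ∈ Finset.range (C₁ + 1), ∑ L : SimpleGraph (Fin k), n ⟨k, L⟩ + 1, Nat.succ_pos _, ?_⟩
  intro V _ L hV hL
  let e := Finite.equivFin V
  obtain ⟨W, hW, f, A, hcard, ⟨hindep, hA, hLA⟩, hd⟩ := hn ⟨_, L.map e.toEmbedding⟩ (hL.map e)
  have hrange : Set.range (e.toEmbedding.trans f) = Set.range f := by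
    rw [Function.Embedding.coe_trans]
    exact e.surjective.range_comp f
  refine ⟨W, hW, e.toEmbedding.trans f, A, ?_, ⟨?_, hA, ?_⟩, ?_⟩
  · refine (hcard.trans ?_).trans (Nat.le_succ _)
    refine le_trans ?_ (Finset.single_le_sum (f := fun k => ∑ L : SimpleGraph (Fin k), n ⟨k, L⟩)
      (fun _ _ => Nat.zero_le _) (Finset.mem_range.2 (Nat.lt_succ_of_le hV)))
    exact Finset.single_le_sum (f := fun L : SimpleGraph (Fin (Nat.card V)) => n ⟨_, L⟩)
      (fun _ _ => Nat.zero_le _) (Finset.mem_univ _)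
  · rwa [hrange]
  · rwa [Function.Embedding.coe_trans, ← SimpleGraph.map_map]
  · rwa [hrange]

end Absorber

theorem mainTheorem8 (q : ℕ) (hq : 4 ≤ q) :
    absorberThreshold q ≤ (((q : ℝ) + 1 / 2 : ℝ) : EReal) := by
  refine iInf_le_of_le ((q : ℝ) + 1 / 2) (iInf_le_of_le (by positivity) ?_)
  exact iInf_le_of_le (hasAbsorbersOfTwoDensity hq) le_rfl
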